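/- Let $k,l\ge 0$ be integers and let $\Delta(2,k,l)=\langle x,y\mid x^2=y^k=(xy)^l=1\rangle$ act on the right, $s\mapsto s^g$, on a finite set $S$. Let $J$ be the 2-complex built as follows. * The vertices are the elements of $S$. For every $s\in S$ and $a\in\{x,y\}$ there is an oriented $a$-edge from $s$ to $s^a$. Whenever $s^x\neq s$, the $x$-edge from $s$ to $s^x$ and the $x$-edge from $s^x$ to $s$ are identified, with opposite directions, to one unoriented edge. (This is the coset graph.) * For every fixed point $s$ of $x$, a disc (an $x$-monogon) is attached along the loop given by the $x$-edge at $s$. * For every orbit of $\langle y\rangle$ on $S$, with $n$ points, an $n$-gon (a $y$-face) is attached along the closed path that starts at a point of the orbit and traverses $n$ successive $y$-edges. * For every orbit of $\langle xy\rangle$ on $S$, with $m$ points, a $2m$-gon (an $xy$-face) is attached along the closed path that starts at a point of the orbit and traverses alternately $x$-edges and $y$-edges, reading $(xy)^m$. Then $J$, with the quotient topology, is homeomorphic to a compact orientable surface without boundary. If moreover $S$ is non-empty and the action is transitive, then $J$ is connected. -/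

import Mathlib

open scoped Manifold ContDiff RightActions

universe u

namespace CosetComplex

/-- The two generators `x`, `y`. -/
inductive Gen : Type
  | x
  | y

/-- The relators `x ^ 2`, `y ^ k`, `(x y) ^ l`. -/
def triangleRels (k l : ℕ) : Set (FreeGroup Gen) :=
  {FreeGroup.of Gen.x ^ 2, FreeGroup.of Gen.y ^ k,
    (FreeGroup.of Gen.x * FreeGroup.of Gen.y) ^ l}

/-- The triangle group `Δ(2,k,l) = ⟨x, y ∣ x² = yᵏ = (xy)ˡ = 1⟩`. -/
abbrev TriangleGroup (k l : ℕ) : Type := PresentedGroup (triangleRels k l)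

/-- The elements `x` and `y` of `Δ(2,k,l)`. -/
def gen (k l : ℕ) (a : Gen) : TriangleGroup k l := PresentedGroup.of a

/-- The orbits of `⟨g⟩` on `S`, for a right action of `G` on `S`; `s <• g` is the image `s ^ g`. -/
abbrev CyclicOrbit {G : Type*} [Group G] (S : Type u) [MulAction Gᵐᵒᵖ S] (g : G) : Type u :=
  MulAction.orbitRel.Quotient (Subgroup.zpowers (MulOpposite.op g)) S

section Complex

variable (k l : ℕ) (S : Type u) [MulAction (TriangleGroup k l)ᵐᵒᵖ S]

/-- The (oriented) edges of the coset graph: the pair `(a, s)` is the `a`-edge which runs from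
the vertex `s` to the vertex `s ^ a`. -/
abbrev Edge : Type u := Gen × S

/-- The faces: one `x`-monogon for each fixed point of `x`, one `y`-face for each orbit of `⟨y⟩`
and one `xy`-face for each orbit of `⟨xy⟩`. -/
inductive Face : Type u
  | xMonogon (s : S) (hs : s <• gen k l Gen.x = s)
  | yFace (o : CyclicOrbit S (gen k l Gen.y))
  | xyFace (o : CyclicOrbit S (gen k l Gen.x * gen k l Gen.y))

variable {k l S}

/-- The number of sides of a face: an `x`-monogon has one side, a `y`-face has as many sides as
its orbit has points, an `xy`-face has twice as many sides as its orbit has points. -/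
noncomputable def Face.sides : Face k l S → ℕ
  | .xMonogon _ _ => 1
  | .yFace o => MulAction.period (MulOpposite.op (gen k l Gen.y)) o.out
  | .xyFace o => 2 * MulAction.period (MulOpposite.op (gen k l Gen.x * gen k l Gen.y)) o.out

/-- The `j`-th edge (`j < sides`) of the circuit along which a face is attached. The circuit of a
`y`-face starts at some point `s` of the orbit and reads `y y y ⋯`; that of an `xy`-face starts at
some point `s` of the orbit and reads `x y x y ⋯`. All edges are traversed in their direction. -/
noncomputable def Face.side : Face k l S → ℕ → Edge S
  | .xMonogon s _, _ => (Gen.x, s)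
  | .yFace o, j => (Gen.y, o.out <• gen k l Gen.y ^ j)
  | .xyFace o, j =>
      if j % 2 = 0 then
        (Gen.x, o.out <• (gen k l Gen.x * gen k l Gen.y) ^ (j / 2))
      else
        (Gen.y, o.out <• ((gen k l Gen.x * gen k l Gen.y) ^ (j / 2) * gen k l Gen.x))

/-- The point `exp (i θ)` on the boundary of the closed unit disc. -/
noncomputable def boundaryPoint (θ : ℝ) : Metric.closedBall (0 : ℂ) 1 :=
  ⟨Circle.exp θ, by simp⟩

variable (k l S)

/-- The disjoint union of all cells: a point for each vertex, a unit interval for each oriented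
edge and a closed disc for each face (`Sigma` and `⊕` carry the disjoint union topology). -/
abbrev Cells : Type u :=
  (Σ _ : S, PUnit.{1}) ⊕ (Σ _ : Edge S, unitInterval) ⊕
    (Σ _ : Face k l S, Metric.closedBall (0 : ℂ) 1)

variable {S}

/-- The point of `Cells` given by a vertex. -/
def vertexPt (s : S) : Cells k l S := Sum.inl ⟨s, PUnit.unit⟩

/-- The point at parameter `t` on an edge. -/
def edgePt (e : Edge S) (t : unitInterval) : Cells k l S := Sum.inr (Sum.inl ⟨e, t⟩)

variable {k l}

/-- The point `z` of the closed disc that belongs to a face. -/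
def facePt (f : Face k l S) (z : Metric.closedBall (0 : ℂ) 1) : Cells k l S :=
  Sum.inr (Sum.inr ⟨f, z⟩)

variable (k l S)

/-- The identifications between points of cells.
* Each edge `(a, s)` starts at `s` and ends at `s ^ a`.
* If `x` moves `s`, then the `x`-edge from `s` to `s ^ x` and the `x`-edge from `s ^ x` to `s` are
  identified, with opposite directions, and become one unoriented edge.
* The boundary circle of a face with `n` sides is cut into `n` arcs of equal length, and the
  `j`-th arc is glued along the `j`-th edge of the circuit of that face. -/
inductive Glue : Cells k l S → Cells k l S → Prop
  | source (a : Gen) (s : S) : Glue (edgePt k l (a, s) 0) (vertexPt k l s)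
  | target (a : Gen) (s : S) : Glue (edgePt k l (a, s) 1) (vertexPt k l (s <• gen k l a))
  | flip (s : S) (hs : s <• gen k l Gen.x ≠ s) (t : unitInterval) :
      Glue (edgePt k l (Gen.x, s) t)
        (edgePt k l (Gen.x, s <• gen k l Gen.x) (unitInterval.symm t))
  | attach (f : Face k l S) (j : ℕ) (hj : j < f.sides) (t : unitInterval) :
      Glue (facePt f (boundaryPoint (2 * Real.pi * ((j : ℝ) + (t : ℝ)) / (f.sides : ℝ))))
        (edgePt k l (f.side j) t)

/-- The 2-complex `J`, with the quotient topology. -/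
def J : Type u := Quot (Glue k l S)

instance : TopologicalSpace (J k l S) :=
  inferInstanceAs (TopologicalSpace (Quot (Glue k l S)))

end Complex

/-- `M` is (the underlying space of) a compact orientable surface without boundary: it is compact,
Hausdorff and second countable, and it has a smooth atlas of charts onto open subsets of `ℝ²` all
of whose coordinate changes have positive Jacobian determinant. -/
def IsCompactOrientableSurface (M : Type u) [TopologicalSpace M] : Prop :=
  CompactSpace M ∧ T2Space M ∧ SecondCountableTopology M ∧
    ∃ _ : ChartedSpace (EuclideanSpace ℝ (Fin 2)) M,
      IsManifold (𝓡 2) ∞ M ∧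
      ∀ e ∈ atlas (EuclideanSpace ℝ (Fin 2)) M, ∀ e' ∈ atlas (EuclideanSpace ℝ (Fin 2)) M,
        ∀ p ∈ (e.symm.trans e').source, 0 < (fderiv ℝ (e.symm.trans e') p).det

end CosetComplex

section

open Set Filter Topology

/-! ### Surfaces from parametrizations with holomorphic coordinate changes -/

namespace CosetComplex

/-! Orient the `xy`-faces along their boundary words, the `y`-faces and the monogons against theirs.
Then every edge of the coset graph is traversed by exactly two sides of faces, once in each
direction: a `y`-edge by a `y`-face and an `xy`-face, an `x`-loop by a monogon and an `xy`-face, and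
an `x`-edge between two points by two sides of `xy`-faces, since the edges at `s` and `s ^ x` are
glued in reverse. The sides that start at a vertex `s` form a single cycle under rotation, of length
3 if `x` moves `s` and 4 if `x` fixes `s`. Polygons glued in this way form a closed oriented
surface.

The general statement about polygons, `PolygonGluing.IsSurface.isCompactOrientableSurface`, is
proved with holomorphic charts. The map `w ↦ exp (2πiw/n)` wraps the closed upper half plane around
a punctured `n`-gon, with unit intervals as sides. Two half planes are joined along an edge by `ζ ↦
1 - ζ`. At a vertex with `d` corners, `d` half planes of angle `π` fit together and the coordinate
is `u = ζ ^ (2/d)`. All coordinate changes are analytic, so their real Jacobian is a squared modulus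
and is positive; `isCompactOrientableSurface_of_charts` turns this into an atlas.

A continuous level function, `(‖z‖, ‖1 - z ^ n‖)` on an `n`-gon, tells interiors of faces, edges and
vertices apart. With it, the Hausdorff property and the comparison of charts reduce to points of the
same kind. `isSurface_gluing` verifies the combinatorial conditions for `J`; points of the quotient
are proved distinct by means of functions on the cells that respect `Glue`.

Connectedness: edges keep a vertex and its images under the generators in one component, and every
face contains a vertex. -/

/-- Two maps `φ`, `χ` from `ℂ` to the same space are related at `a`, `b` if near these points they
differ by analytic changes of coordinates. -/
def ChartRel {J : Type*} (φ χ : ℂ → J) (a b : ℂ) : Prop :=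
  ∃ g h : ℂ → ℂ, AnalyticAt ℂ g a ∧ AnalyticAt ℂ h b ∧ g a = b ∧ h b = a ∧
    (∀ᶠ w in 𝓝 a, χ (g w) = φ w) ∧ ∀ᶠ w in 𝓝 b, φ (h w) = χ w

namespace ChartRel

variable {J : Type*} {φ χ η : ℂ → J} {a b c : ℂ}

theorem symm (H : ChartRel φ χ a b) : ChartRel χ φ b a := by
  obtain ⟨g, h, hg, hh, ga, hb, h1, h2⟩ := H
  exact ⟨h, g, hh, hg, hb, ga, h2, h1⟩

theorem of_eventuallyEq (H : ∀ᶠ w in 𝓝 a, χ w = φ w) : ChartRel φ χ a a :=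
  ⟨id, id, analyticAt_id, analyticAt_id, rfl, rfl, H, H.mono fun _ hw => hw.symm⟩

theorem refl (φ : ℂ → J) (a : ℂ) : ChartRel φ φ a a :=
  of_eventuallyEq (Eventually.of_forall fun _ => rfl)

theorem trans (H : ChartRel φ χ a b) (K : ChartRel χ η b c) : ChartRel φ η a c := by
  obtain ⟨g, h, hg, hh, rfl, hb, h1, h2⟩ := H
  obtain ⟨g', h', hg', hh', rfl, hb', h1', h2'⟩ := K
  refine ⟨g' ∘ g, h ∘ h', hg'.comp hg, AnalyticAt.comp (by rwa [hb']) hh', rfl, by simp [hb', hb],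
    ?_, ?_⟩
  · filter_upwards [h1, hg.continuousAt.eventually h1'] with w hw hw'
    simp [hw, hw']
  · have := hh'.continuousAt
    rw [ContinuousAt, hb'] at this
    filter_upwards [h2', this.eventually h2] with w hw hw'
    simp [hw, hw']

theorem apply_eq (H : ChartRel φ χ a b) : φ a = χ b := by
  obtain ⟨g, h, hg, hh, rfl, hb, h1, h2⟩ := H
  exact h1.self_of_nhds.symm

end ChartRel

/-- The determinant is the norm of `c` from `ℂ` to `ℝ`, that is `|c|²`. Orientability comes from
here. -/
theorem det_smul_complex_pos {c : ℂ} (hc : c ≠ 0) :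
    0 < LinearMap.det ((LinearMap.mulLeft ℝ c)) := by
  have : LinearMap.det (LinearMap.mulLeft ℝ c) = Complex.normSq c := by
    have h := Algebra.norm_complex_apply c
    rw [Algebra.norm_apply] at h
    exact h
  rw [this]
  exact Complex.normSq_pos.2 hc

/-- The inverse of an injective, continuous and open parametrization by an open subset of `ℂ`. -/
noncomputable def chartOfParam {J : Type*} [TopologicalSpace J] (ψ : ℂ → J) (V : Set ℂ)
    (hV : IsOpen V) (hc : ContinuousOn ψ V) (hi : InjOn ψ V)
    (ho : ∀ B ⊆ V, IsOpen B → IsOpen (ψ '' B)) : OpenPartialHomeomorph ℂ J :=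
  OpenPartialHomeomorph.ofContinuousOpenRestrict (hi.toPartialEquiv) hc (by
    intro B hB
    have : V.domRestrict ψ '' B = ψ '' (Subtype.val '' B) := by
      rw [image_image]; rfl
    change IsOpen (V.domRestrict ψ '' B)
    rw [this]
    exact ho _ (by rintro _ ⟨x, -, rfl⟩; exact x.2) (hV.isOpenMap_subtype_val _ hB)) hV

/-- The inverses of the `ψ c` form the atlas. By `hrel` each transition map is locally a holomorphic
`g`, hence smooth, and its real derivative is multiplication by `g'`. -/
theorem isCompactOrientableSurface_of_charts {J : Type u} [TopologicalSpace J] [CompactSpace J]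
    [T2Space J] {C : Type*} (V : C → Set ℂ) (ψ : C → ℂ → J) (hV : ∀ c, IsOpen (V c))
    (hcont : ∀ c, ContinuousOn (ψ c) (V c)) (hinj : ∀ c, InjOn (ψ c) (V c))
    (hopen : ∀ c, ∀ B ⊆ V c, IsOpen B → IsOpen (ψ c '' B))
    (hcover : ∀ p, ∃ c, ∃ z ∈ V c, ψ c z = p)
    (hrel : ∀ c c' a b, a ∈ V c → b ∈ V c' → ψ c a = ψ c' b → ChartRel (ψ c) (ψ c') a b) :
    IsCompactOrientableSurface J := by
  classical
  let κ : ℂ ≃L[ℝ] EuclideanSpace ℝ (Fin 2) :=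
    Complex.orthonormalBasisOneI.repr.toContinuousLinearEquiv
  let P : C → OpenPartialHomeomorph ℂ J := fun c =>
    chartOfParam (ψ c) (V c) (hV c) (hcont c) (hinj c) (hopen c)
  have hP : ∀ c, (P c : ℂ → J) = ψ c := fun c => rfl
  have hPs : ∀ c, (P c).source = V c := fun c => rfl
  have hPt : ∀ c, (P c).target = ψ c '' V c := fun c => rfl
  let e : C → OpenPartialHomeomorph J (EuclideanSpace ℝ (Fin 2)) := fun c =>
    (P c).symm.trans κ.toHomeomorph.toOpenPartialHomeomorph
  have key : ∀ c c', ∀ p ∈ ((e c).symm.trans (e c')).source, ∃ g : ℂ → ℂ,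
      AnalyticAt ℂ g (κ.symm p) ∧ deriv g (κ.symm p) ≠ 0 ∧
      ((e c).symm.trans (e c') : EuclideanSpace ℝ (Fin 2) → _) =ᶠ[𝓝 p] κ ∘ g ∘ κ.symm := by
    intro c c' p hp
    have hp1 : κ.symm p ∈ V c := by
      have h := hp.1
      simp only [e, OpenPartialHomeomorph.trans_symm_eq_symm_trans_symm] at h
      simpa [hPs] using h
    have hp2 : ψ c (κ.symm p) ∈ ψ c' '' V c' := by
      have h := hp.2
      simp only [e, OpenPartialHomeomorph.trans_symm_eq_symm_trans_symm] at h
      simpa [hP, hPt] using h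
    obtain ⟨b, hb, hbe⟩ := hp2
    obtain ⟨g, h, hg, hh, ga, hb', h1, h2⟩ := hrel c c' _ b hp1 hb hbe.symm
    have hgV : ∀ᶠ w in 𝓝 (κ.symm p), g w ∈ V c' :=
      hg.continuousAt.eventually_mem (by rw [ga]; exact (hV c').mem_nhds hb)
    refine ⟨g, hg, ?_, ?_⟩
    -- `ChartRel` does not say that `g` and `h` are mutually inverse; injectivity of `ψ c` on `V c`
    -- forces `h ∘ g = id` near the point, and the chain rule then excludes `g' = 0`.
    · have hid : h ∘ g =ᶠ[𝓝 (κ.symm p)] id := by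
        have hhg : ContinuousAt (h ∘ g) (κ.symm p) :=
          ContinuousAt.comp (by rw [ga]; exact hh.continuousAt) hg.continuousAt
        have h2' := hg.continuousAt.eventually (by rw [ga]; exact h2)
        filter_upwards [h1, h2', (hV c).mem_nhds hp1,
          hhg.eventually_mem (by simp only [Function.comp, ga, hb']; exact (hV c).mem_nhds hp1)]
          with w w1 w2 w3 w4
        exact hinj c w4 w3 (by simp only [Function.comp]; rw [w2, w1, id])
      have hd : HasDerivAt (h ∘ g) (deriv h (g (κ.symm p)) * deriv g (κ.symm p)) (κ.symm p) :=
        HasDerivAt.comp _ (by rw [ga]; exact hh.differentiableAt.hasDerivAt)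
          hg.differentiableAt.hasDerivAt
      have := hd.unique ((hasDerivAt_id _).congr_of_eventuallyEq hid)
      intro h0
      simp [h0] at this
    · filter_upwards [κ.symm.continuous.continuousAt.eventually h1,
        κ.symm.continuous.continuousAt.eventually hgV] with x hx hx'
      simp only [e, OpenPartialHomeomorph.trans_symm_eq_symm_trans_symm]
      simp only [Function.comp, OpenPartialHomeomorph.coe_trans, OpenPartialHomeomorph.symm_symm,
        hP, Homeomorph.toOpenPartialHomeomorph_apply, Homeomorph.toOpenPartialHomeomorph_symm_apply]
      change κ ((P c').symm (ψ c (κ.symm x))) = _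
      rw [← hx, ← hP, (P c').left_inv hx']
  choose idx par hpar hidx using hcover
  let cs : ChartedSpace (EuclideanSpace ℝ (Fin 2)) J :=
    { atlas := range e
      chartAt := fun p => e (idx p)
      mem_chart_source := fun p => by
        simp only [e, OpenPartialHomeomorph.trans_source, OpenPartialHomeomorph.symm_source, hPt]
        exact ⟨⟨par p, hpar p, hidx p⟩, mem_univ _⟩
      chart_mem_atlas := fun p => mem_range_self _ }
  have h2 : SecondCountableTopology J :=
    ChartedSpace.secondCountable_of_sigmaCompact (EuclideanSpace ℝ (Fin 2)) J
  refine ⟨inferInstance, inferInstance, h2, cs, ?_, ?_⟩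
  · refine isManifold_of_contDiffOn _ _ _ ?_
    rintro _ _ ⟨c, rfl⟩ ⟨c', rfl⟩ p hp
    simp only [mfld_simps, modelWithCornersSelf_coe_symm] at hp
    obtain ⟨g, hg, -, hge⟩ := key c c' p (by simpa only [mfld_simps] using hp)
    have : ContDiffAt ℝ ∞ ((e c).symm.trans (e c')) p := by
      refine ContDiffAt.congr_of_eventuallyEq ?_ hge
      exact κ.contDiff.contDiffAt.comp p
        (ContDiffAt.comp p (hg.contDiffAt.restrict_scalars ℝ) κ.symm.contDiff.contDiffAt)
    exact this.contDiffWithinAt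
  · rintro _ ⟨c, rfl⟩ _ ⟨c', rfl⟩ p hp
    obtain ⟨g, hg, hg0, hge⟩ := key c c' p hp
    have hgd : HasFDerivAt g ((ContinuousLinearMap.toSpanSingleton ℂ
        (deriv g (κ.symm p))).restrictScalars ℝ) (κ.symm p) :=
      hg.differentiableAt.hasDerivAt.hasFDerivAt.restrictScalars ℝ
    have hd := (κ.hasFDerivAt.comp p (hgd.comp p κ.symm.hasFDerivAt)).congr_of_eventuallyEq hge
    rw [hd.fderiv]
    have : ((κ : ℂ →L[ℝ] EuclideanSpace ℝ (Fin 2)).comp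
        (((ContinuousLinearMap.toSpanSingleton ℂ (deriv g (κ.symm p))).restrictScalars ℝ).comp
          (κ.symm : EuclideanSpace ℝ (Fin 2) →L[ℝ] ℂ))).det =
        LinearMap.det (LinearMap.mulLeft ℝ (deriv g (κ.symm p))) := by
      rw [← LinearMap.det_conj (LinearMap.mulLeft ℝ (deriv g (κ.symm p))) κ.toLinearEquiv,
        ContinuousLinearMap.det]
      congr 1
      ext x i
      simp [mul_comm]
    rw [this]
    exact det_smul_complex_pos hg0

end CosetComplex

/-! ### Wrapping the half plane around a polygon; the conditions on a gluing -/

namespace CosetComplex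

/-- The universal covering of the punctured unit disc by the upper half plane, normalized so that
the boundary arcs of an `n`-gon are the unit intervals between integers. -/
noncomputable def discParam (n : ℕ) (w : ℂ) : ℂ := Complex.exp (2 * Real.pi * Complex.I * w / n)

theorem norm_discParam (n : ℕ) (w : ℂ) :
    ‖discParam n w‖ = Real.exp (-(2 * Real.pi * w.im / n)) := by
  rw [discParam, Complex.norm_exp]
  congr 1
  rw [show (2 * Real.pi * Complex.I * w / n : ℂ) = ((2 * Real.pi / n : ℝ) : ℂ) * (Complex.I * w) by
    push_cast; ring, Complex.re_ofReal_mul]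
  simp; ring

theorem norm_discParam_le_one {n : ℕ} (hn : 0 < n) {w : ℂ} : ‖discParam n w‖ ≤ 1 ↔ 0 ≤ w.im := by
  have : 0 < 2 * Real.pi / n := by positivity
  rw [norm_discParam, Real.exp_le_one_iff, neg_nonpos,
    show 2 * Real.pi * w.im / n = 2 * Real.pi / n * w.im by ring, mul_nonneg_iff_of_pos_left this]

theorem norm_discParam_lt_one {n : ℕ} (hn : 0 < n) {w : ℂ} : ‖discParam n w‖ < 1 ↔ 0 < w.im := by
  have : 0 < 2 * Real.pi / n := by positivity
  rw [norm_discParam, Real.exp_lt_one_iff, neg_lt_zero,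
    show 2 * Real.pi * w.im / n = 2 * Real.pi / n * w.im by ring, mul_pos_iff_of_pos_left this]

theorem discParam_pow {n : ℕ} (hn : 0 < n) (w : ℂ) :
    discParam n w ^ n = Complex.exp (2 * Real.pi * Complex.I * w) := by
  rw [discParam, ← Complex.exp_nat_mul]
  congr 1
  have : (n : ℂ) ≠ 0 := by exact_mod_cast hn.ne'
  field_simp

theorem discParam_eq_iff {n : ℕ} (hn : 0 < n) {w w' : ℂ} :
    discParam n w = discParam n w' ↔ ∃ k : ℤ, w = w' + k * n := by
  have h1 : (n : ℂ) ≠ 0 := by exact_mod_cast hn.ne'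
  have h2 := Complex.two_pi_I_ne_zero
  rw [discParam, discParam, Complex.exp_eq_exp_iff_exists_int]
  refine exists_congr fun k => ⟨fun h => ?_, fun h => ?_⟩
  · have : (2 * Real.pi * Complex.I) * w = (2 * Real.pi * Complex.I) * (w' + k * n) := by
      field_simp at h
      linear_combination (2 * Real.pi * Complex.I) * h
    exact mul_left_cancel₀ h2 this
  · rw [h]; field_simp

theorem exists_discParam_eq {n : ℕ} (hn : 0 < n) {z : ℂ} (hz : z ≠ 0) : ∃ w, discParam n w = z := by
  have h1 : (n : ℂ) ≠ 0 := by exact_mod_cast hn.ne'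
  have h2 := Complex.two_pi_I_ne_zero
  refine ⟨n / (2 * Real.pi * Complex.I) * Complex.log z, ?_⟩
  rw [discParam]
  convert Complex.exp_log hz using 2
  field_simp

/-- A local branch of the logarithm through any prescribed value `w`: the principal logarithm is
only applied to `z / z₀`, which is near 1 and so away from the cut. -/
theorem exists_analyticAt_exp_eq {a w : ℂ} (ha : a ≠ 0) : ∃ s : ℂ → ℂ,
    AnalyticAt ℂ s (Complex.exp (a * w)) ∧ s (Complex.exp (a * w)) = w ∧
      ∀ᶠ z in 𝓝 (Complex.exp (a * w)), Complex.exp (a * s z) = z := by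
  set z₀ := Complex.exp (a * w)
  have hz : z₀ ≠ 0 := Complex.exp_ne_zero _
  refine ⟨fun z => w + a⁻¹ * Complex.log (z / z₀), ?_, by simp [div_self hz], ?_⟩
  · refine analyticAt_const.add (analyticAt_const.mul ?_)
    refine AnalyticAt.clog (analyticAt_id.div analyticAt_const hz) ?_
    simp [div_self hz]
  · filter_upwards [isOpen_ne.mem_nhds hz] with z hz'
    rw [mul_add, Complex.exp_add, mul_inv_cancel_left₀ ha, Complex.exp_log (div_ne_zero hz' hz),
      mul_div_cancel₀ _ hz]

theorem analyticAt_discParam (n : ℕ) (c w : ℂ) :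
    AnalyticAt ℂ (fun ζ => discParam n (c + ζ)) w := by
  unfold discParam
  fun_prop

theorem exists_analyticAt_discParam_eq {n : ℕ} (hn : 0 < n) (c w : ℂ) : ∃ s : ℂ → ℂ,
    AnalyticAt ℂ s (discParam n (c + w)) ∧ s (discParam n (c + w)) = w ∧
      ∀ᶠ z in 𝓝 (discParam n (c + w)), discParam n (c + s z) = z := by
  have h1 : (n : ℂ) ≠ 0 := by exact_mod_cast hn.ne'
  have ha : (2 * Real.pi * Complex.I / n : ℂ) ≠ 0 := div_ne_zero Complex.two_pi_I_ne_zero h1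
  have hd : ∀ v, discParam n v = Complex.exp (2 * Real.pi * Complex.I / n * v) := fun v => by
    rw [discParam]; congr 1; ring
  obtain ⟨s, h1, h2, h3⟩ := exists_analyticAt_exp_eq (w := c + w) ha
  refine ⟨fun z => s z - c, ?_, ?_, ?_⟩
  · rw [hd]; exact h1.sub analyticAt_const
  · simp only [hd, h2]; ring
  · rw [hd]
    filter_upwards [h3] with z hz
    rw [hd]; rw [add_sub_cancel, hz]

/-- Data of a surface glued from polygons: the discs `disc f`, each with `sides f` sides, their
sides (darts) `δ : D`, the successor `next` of a dart on its face, the pairing `pair` of darts, and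
the start vertex `vert` of a dart, where the dart `base v` starts at the vertex `v`. -/
structure PolygonGluing (J F D V : Type*) where
  disc : F → ℂ → J
  sides : F → ℕ
  face : D → F
  pos : D → ℤ
  next : Equiv.Perm D
  pair : Equiv.Perm D
  vert : D → V
  base : V → D

namespace PolygonGluing

variable {J F D V : Type*}

/-- The closed upper half plane wrapped around a face, with the dart `δ` along `[0, 1]`. -/
noncomputable def side (P : PolygonGluing J F D V) (δ : D) (ζ : ℂ) : J :=
  P.disc (P.face δ) (discParam (P.sides (P.face δ)) (P.pos δ + ζ))

/-- The counterclockwise rotation of the darts around their start vertices. -/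
def rotate (P : PolygonGluing J F D V) : Equiv.Perm D := P.pair * P.next⁻¹

/-- The conditions under which the polygons are glued to a closed oriented surface `J`. -/
structure IsSurface [TopologicalSpace J] (P : PolygonGluing J F D V) : Prop where
  sides_pos : ∀ f, 0 < P.sides f
  continuous_disc : ∀ f, Continuous (P.disc f)
  disc_surj : ∀ p, ∃ f z, ‖z‖ ≤ 1 ∧ P.disc f z = p
  isOpen_of : ∀ O : Set J, (∀ f z, ‖z‖ ≤ 1 → P.disc f z ∈ O →
    ∀ᶠ z' in 𝓝 z, ‖z'‖ ≤ 1 → P.disc f z' ∈ O) → IsOpen O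
  disc_inj : ∀ f f' z z', ‖z‖ < 1 → ‖z'‖ < 1 → P.disc f z = P.disc f' z' → f = f' ∧ z = z'
  exists_level : ∃ γ : J → ℝ × ℝ, Continuous γ ∧
    ∀ f z, ‖z‖ ≤ 1 → γ (P.disc f z) = (‖z‖, ‖1 - z ^ P.sides f‖)
  face_surj : ∀ f, ∃ δ, P.face δ = f
  face_next : ∀ δ, P.face (P.next δ) = P.face δ
  pos_next : ∀ δ, ∃ k : ℤ, P.pos (P.next δ) = P.pos δ + 1 + k * P.sides (P.face δ)
  dart_ext : ∀ δ δ', P.face δ = P.face δ' →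
    (∃ k : ℤ, P.pos δ = P.pos δ' + k * P.sides (P.face δ')) → δ = δ'
  pair_pair : ∀ δ, P.pair (P.pair δ) = δ
  pair_ne : ∀ δ, P.pair δ ≠ δ
  glue : ∀ δ, ∀ t : ℝ, 0 ≤ t → t ≤ 1 → P.side δ t = P.side (P.pair δ) (1 - t)
  edge_inj : ∀ δ δ', ∀ t t' : ℝ, 0 < t → t < 1 → 0 < t' → t' < 1 → P.side δ t = P.side δ' t' →
    (δ' = δ ∧ t' = t) ∨ (δ' = P.pair δ ∧ t' = 1 - t)
  vert_eq : ∀ δ δ', P.side δ 0 = P.side δ' 0 → P.vert δ = P.vert δ'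
  vert_base : ∀ v, P.vert (P.base v) = v
  exists_rotate : ∀ δ, ∃ m : ℤ, δ = (P.rotate ^ m) (P.base (P.vert δ))

end PolygonGluing
end CosetComplex

/-! ### Coordinates along the sides and across the edges -/

namespace CosetComplex
namespace PolygonGluing

variable {J F D V : Type*} {P : PolygonGluing J F D V}

/-- The two closed half planes along a dart and its partner, put together. -/
noncomputable def doubleSide (P : PolygonGluing J F D V) (δ : D) (ζ : ℂ) : J :=
  if 0 ≤ ζ.im then P.side δ ζ else P.side (P.pair δ) (1 - ζ)

theorem doubleSide_of_nonneg {δ : D} {ζ : ℂ} (h : 0 ≤ ζ.im) :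
    P.doubleSide δ ζ = P.side δ ζ := if_pos h

/-- The wrapping map has a local analytic inverse `s`. The bound on `(s z).im` is kept because
`doubleSide` agrees with `side` only on the closed upper half plane. -/
theorem chartRel_disc_side {δ : D} (hn : 0 < P.sides (P.face δ)) (ζ : ℂ) : ∃ s : ℂ → ℂ,
    AnalyticAt ℂ s (discParam (P.sides (P.face δ)) (P.pos δ + ζ)) ∧
    s (discParam (P.sides (P.face δ)) (P.pos δ + ζ)) = ζ ∧
    (∀ᶠ z in 𝓝 (discParam (P.sides (P.face δ)) (P.pos δ + ζ)),
      P.side δ (s z) = P.disc (P.face δ) z ∧ (‖z‖ ≤ 1 → 0 ≤ (s z).im)) ∧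
    ChartRel (P.disc (P.face δ)) (P.side δ)
      (discParam (P.sides (P.face δ)) (P.pos δ + ζ)) ζ := by
  obtain ⟨s, h1, h2, h3⟩ := exists_analyticAt_discParam_eq hn (P.pos δ) ζ
  have h4 : ∀ᶠ z in 𝓝 (discParam (P.sides (P.face δ)) (P.pos δ + ζ)),
      P.side δ (s z) = P.disc (P.face δ) z ∧ (‖z‖ ≤ 1 → 0 ≤ (s z).im) := by
    filter_upwards [h3] with z hz
    refine ⟨by rw [side, hz], fun h => ?_⟩
    rw [← hz, norm_discParam_le_one hn] at h
    simpa using h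
  exact ⟨s, h1, h2, h4, s, _, h1, analyticAt_discParam _ _ _, h2, rfl, h4.mono fun _ h => h.1,
    Eventually.of_forall fun _ => rfl⟩

namespace IsSurface

variable [TopologicalSpace J] (hP : P.IsSurface)
include hP

theorem continuous_side (δ : D) : Continuous (P.side δ) := by
  refine (hP.continuous_disc _).comp ?_
  unfold discParam
  fun_prop

theorem face_zpow (δ : D) (m : ℤ) : P.face ((P.next ^ m) δ) = P.face δ := by
  induction m using Int.induction_on with
  | zero => simp
  | succ i ih => rw [add_comm, zpow_add, zpow_one, Equiv.Perm.mul_apply, hP.face_next, ih]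
  | pred i ih =>
    rw [← ih, ← hP.face_next, ← Equiv.Perm.mul_apply, ← zpow_one_add]
    congr 3; ring

theorem pos_zpow (δ : D) (m : ℤ) :
    ∃ k : ℤ, P.pos ((P.next ^ m) δ) = P.pos δ + m + k * P.sides (P.face δ) := by
  induction m using Int.induction_on with
  | zero => exact ⟨0, by simp⟩
  | succ i ih =>
    obtain ⟨k, hk⟩ := ih
    obtain ⟨k', hk'⟩ := hP.pos_next ((P.next ^ (i : ℤ)) δ)
    rw [hP.face_zpow] at hk'
    refine ⟨k + k', ?_⟩
    rw [add_comm (i : ℤ), zpow_add, zpow_one, Equiv.Perm.mul_apply, hk', hk]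
    ring
  | pred i ih =>
    obtain ⟨k, hk⟩ := ih
    obtain ⟨k', hk'⟩ := hP.pos_next ((P.next ^ (-(i : ℤ) - 1)) δ)
    rw [hP.face_zpow, ← Equiv.Perm.mul_apply, ← zpow_one_add,
      show 1 + (-(i : ℤ) - 1) = -i by ring, hk] at hk'
    exact ⟨k - k', by linear_combination -hk'⟩

theorem side_zpow (δ : D) (m : ℤ) (ζ : ℂ) : P.side ((P.next ^ m) δ) ζ = P.side δ (ζ + m) := by
  obtain ⟨k, hk⟩ := hP.pos_zpow δ m
  rw [side, side, hP.face_zpow]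
  congr 1
  rw [discParam_eq_iff (hP.sides_pos _)]
  refine ⟨k, ?_⟩
  rw [hk]; push_cast; ring

theorem pair_rotate (δ : D) : P.pair (P.rotate δ) = P.next⁻¹ δ := by
  simp [rotate, hP.pair_pair]

/-- The partner of `rotate δ` is the side before `δ` on the same face. So the negative real axis of
`δ` near 0 is glued to the positive real axis of `rotate δ`: consecutive corners at a vertex match.
-/
theorem side_rotate (δ : D) (ζ : ℂ) : P.side (P.pair (P.rotate δ)) (1 - ζ) = P.side δ (-ζ) := by
  rw [hP.pair_rotate]
  have := hP.side_zpow δ (-1) (1 - ζ)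
  rw [zpow_neg_one] at this
  rw [this]; congr 1; push_cast; ring

theorem side_rotate_zero (δ : D) : P.side (P.rotate δ) 0 = P.side δ 0 := by
  have h := hP.glue (P.rotate δ) 0 le_rfl zero_le_one
  have h' := hP.side_rotate δ 0
  simp only [Complex.ofReal_zero, neg_zero] at h h'
  rw [h, h']

theorem side_rotate_zpow_zero (δ : D) (m : ℤ) : P.side ((P.rotate ^ m) δ) 0 = P.side δ 0 := by
  induction m using Int.induction_on with
  | zero => simp
  | succ i ih =>
    rw [add_comm, zpow_add, zpow_one, Equiv.Perm.mul_apply, hP.side_rotate_zero, ih]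
  | pred i ih =>
    rw [← ih, ← hP.side_rotate_zero, ← Equiv.Perm.mul_apply, ← zpow_one_add]
    congr 3; ring

/-- Half a turn about `1/2` exchanges the two half planes. On the real line this needs the gluing
condition, which covers `[0, 1]` only. -/
theorem doubleSide_pair {δ : D} {ζ : ℂ} (h : ζ.im ≠ 0 ∨ (0 ≤ ζ.re ∧ ζ.re ≤ 1)) :
    P.doubleSide (P.pair δ) (1 - ζ) = P.doubleSide δ ζ := by
  unfold doubleSide
  rcases lt_trichotomy ζ.im 0 with h' | h' | h'
  · rw [if_pos (by simp; linarith), if_neg (by linarith)]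
  · obtain ⟨h1, h2⟩ := h.resolve_left (by simp [h'])
    have : ζ = (ζ.re : ℂ) := Complex.ext rfl (by simp [h'])
    rw [if_pos (by simp [h']), if_pos (by simp [h']), this, hP.glue δ _ h1 h2]
  · rw [if_neg (by simp; linarith), if_pos (by linarith), hP.pair_pair, sub_sub_cancel]

theorem continuousOn_doubleSide (δ : D) :
    ContinuousOn (P.doubleSide δ) {ζ | 0 < ζ.re ∧ ζ.re < 1} := by
  refine ContinuousOn.if ?_ (hP.continuous_side _).continuousOn ?_
  · rintro ζ ⟨h, h'⟩
    rw [show {ζ : ℂ | 0 ≤ ζ.im} = {ζ : ℂ | (0 : ℝ) ≤ ζ.im} from rfl,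
      Complex.frontier_setOfPred_le_im] at h'
    have : ζ = (ζ.re : ℂ) := Complex.ext rfl (by simpa using h')
    rw [this]
    exact hP.glue δ _ h.1.le h.2.le
  · exact ((hP.continuous_side _).comp (by fun_prop)).continuousOn

theorem exists_side_eq {f : F} {z : ℂ} (hz : z ≠ 0) : ∃ δ ζ, P.face δ = f ∧
    discParam (P.sides (P.face δ)) (P.pos δ + ζ) = z ∧ 0 ≤ ζ.re ∧ ζ.re < 1 := by
  obtain ⟨δ, rfl⟩ := hP.face_surj f
  obtain ⟨w, rfl⟩ := exists_discParam_eq (hP.sides_pos (P.face δ)) hz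
  set ζ := w - P.pos δ
  obtain ⟨k, hk⟩ := hP.pos_zpow δ ⌊ζ.re⌋
  refine ⟨(P.next ^ ⌊ζ.re⌋) δ, ζ - ⌊ζ.re⌋, hP.face_zpow _ _, ?_, ?_, ?_⟩
  · rw [hP.face_zpow, discParam_eq_iff (hP.sides_pos _)]
    refine ⟨k, ?_⟩
    rw [hk]; push_cast; ring
  · simp
  · have := Int.lt_floor_add_one ζ.re
    simp only [Complex.sub_re, Complex.intCast_re]
    linarith

/-- Open faces are embedded, so only the ambiguity of the wrapping map remains, and an integer
translation amounts to a walk around the boundary of the face. -/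
theorem side_eq_interior {δ δ' : D} {ζ ζ' : ℂ} (h : 0 < ζ.im) (h' : 0 < ζ'.im)
    (he : P.side δ ζ = P.side δ' ζ') : ∃ m : ℤ, ζ' = ζ + m ∧ δ = (P.next ^ m) δ' := by
  obtain ⟨h1, h2⟩ := hP.disc_inj _ _ _ _ ((norm_discParam_lt_one (hP.sides_pos _)).2 (by simpa))
    ((norm_discParam_lt_one (hP.sides_pos _)).2 (by simpa)) he
  rw [h1, discParam_eq_iff (hP.sides_pos _)] at h2
  obtain ⟨k, hk⟩ := h2
  refine ⟨P.pos δ - P.pos δ' - k * P.sides (P.face δ'), ?_, ?_⟩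
  · push_cast; linear_combination -hk
  · refine hP.dart_ext _ _ (by rw [h1, hP.face_zpow]) ?_
    obtain ⟨j, hj⟩ := hP.pos_zpow δ' (P.pos δ - P.pos δ' - k * P.sides (P.face δ'))
    exact ⟨k - j, by rw [hj, hP.face_zpow]; ring⟩

/-- In half plane coordinates `z ^ n = exp (2πi (pos + ζ))`, so on the boundary the second component
vanishes exactly at the corners. -/
theorem exists_level_side : ∃ γ : J → ℝ × ℝ, Continuous γ ∧
    (∀ f z, ‖z‖ ≤ 1 → γ (P.disc f z) = (‖z‖, ‖1 - z ^ P.sides f‖)) ∧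
    (∀ δ ζ, 0 < ζ.im → (γ (P.side δ ζ)).1 < 1) ∧
    (∀ δ, ∀ t : ℝ, (γ (P.side δ t)).1 = 1) ∧
    ∀ δ, ∀ t : ℝ, (γ (P.side δ t)).2 = 0 ↔ ∃ m : ℤ, t = m := by
  obtain ⟨γ, h1, h2⟩ := hP.exists_level
  have hp := hP.sides_pos
  have h0 : ∀ (δ) (t : ℝ), ‖discParam (P.sides (P.face δ)) (P.pos δ + t)‖ ≤ 1 := fun δ t =>
    (norm_discParam_le_one (hp _)).2 (by simp)
  refine ⟨γ, h1, h2, fun δ ζ h => ?_, fun δ t => ?_, fun δ t => ?_⟩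
  · have : ‖discParam (P.sides (P.face δ)) (P.pos δ + ζ)‖ < 1 :=
      (norm_discParam_lt_one (hp _)).2 (by simpa)
    rw [side, h2 _ _ this.le]
    exact this
  · rw [side, h2 _ _ (h0 δ t), norm_discParam]
    simp
  · rw [side, h2 _ _ (h0 δ t)]
    simp only [norm_eq_zero, sub_eq_zero, discParam_pow (hp _)]
    rw [eq_comm, Complex.exp_eq_one_iff]
    have h2 := Complex.two_pi_I_ne_zero
    constructor
    · rintro ⟨m, hm⟩
      refine ⟨m - P.pos δ, ?_⟩
      have : (P.pos δ + t : ℂ) = m := mul_left_cancel₀ h2 (by rw [hm]; ring)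
      have : ((t : ℝ) : ℂ) = ((m - P.pos δ : ℤ) : ℝ) := by push_cast; linear_combination this
      exact_mod_cast this
    · rintro ⟨m, hm⟩
      exact ⟨P.pos δ + m, by rw [hm]; push_cast; ring⟩

theorem im_pos_of_side_eq {δ δ' : D} {ζ ζ' : ℂ} (h : 0 < ζ.im) (h' : 0 ≤ ζ'.im)
    (he : P.side δ ζ = P.side δ' ζ') : 0 < ζ'.im := by
  obtain ⟨γ, -, -, h1, h2, -⟩ := hP.exists_level_side
  refine h'.lt_of_ne fun h0 => ?_
  have : ζ' = (ζ'.re : ℂ) := Complex.ext rfl (by simp [h0])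
  have h3 := h1 δ ζ h
  rw [he, this, h2] at h3
  exact lt_irrefl _ h3

/-- Coordinates on the half planes along the darts are unique up to the gluing, in a strip of width
less than one. -/
theorem side_inj {δ δ' : D} {ζ ζ' : ℂ} (h : 0 ≤ ζ.im) (h' : 0 ≤ ζ'.im) (h0 : 0 < ζ.im ∨ 0 < ζ.re)
    (h0' : 0 < ζ'.im ∨ 0 < ζ'.re) (h1 : ζ.re < 1) (h1' : ζ'.re < 1) (h2 : |ζ'.re - ζ.re| < 1)
    (he : P.side δ ζ = P.side δ' ζ') : (δ' = δ ∧ ζ' = ζ) ∨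
      (δ' = P.pair δ ∧ ζ' = 1 - ζ ∧ ζ.im = 0) := by
  rcases h.lt_or_eq with hi | hi
  · obtain ⟨m, rfl, rfl⟩ := hP.side_eq_interior hi (hP.im_pos_of_side_eq hi h' he) he
    have : |(m : ℝ)| < 1 := by simpa using h2
    have : m = 0 := by
      rw [← Int.abs_lt_one_iff]; exact_mod_cast this
    subst this
    simp
  · rcases h'.lt_or_eq with hi' | hi'
    · exact absurd (hP.im_pos_of_side_eq hi' h he.symm) (by rw [← hi]; exact lt_irrefl _)
    have e : ζ = (ζ.re : ℂ) := Complex.ext rfl (by simp [← hi])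
    have e' : ζ' = (ζ'.re : ℂ) := Complex.ext rfl (by simp [← hi'])
    have hr := h0.resolve_left (by simp [← hi])
    have hr' := h0'.resolve_left (by simp [← hi'])
    rw [e, e'] at he
    rcases hP.edge_inj δ δ' _ _ hr h1 hr' h1' he with ⟨a, b⟩ | ⟨a, b⟩
    · exact Or.inl ⟨a, by rw [e, e', b]⟩
    · exact Or.inr ⟨a, by rw [e, e', b]; push_cast; rfl, hi.symm⟩

theorem doubleSide_inj {δ δ' : D} {ζ ζ' : ℂ} (h0 : 0 < ζ.re) (h1 : ζ.re < 1) (h0' : 0 < ζ'.re)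
    (h1' : ζ'.re < 1) (he : P.doubleSide δ ζ = P.doubleSide δ' ζ') :
    (δ' = δ ∧ ζ' = ζ) ∨ (δ' = P.pair δ ∧ ζ' = 1 - ζ) := by
  -- The flip `doubleSide_pair` moves both points to the closed upper half plane, where `side_inj`
  -- applies.
  wlog h : 0 ≤ ζ.im generalizing δ ζ
  · rw [← hP.doubleSide_pair (Or.inl (by linarith))] at he
    have := this (by simp; linarith) (by simp; linarith) he (by simp; linarith)
    rw [hP.pair_pair, sub_sub_cancel] at this
    exact this.symm
  wlog h' : 0 ≤ ζ'.im generalizing δ' ζ'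
  · rw [← hP.doubleSide_pair (δ := δ') (Or.inl (by linarith))] at he
    have := this (by simp; linarith) (by simp; linarith) he (by simp; linarith)
    rcases this with ⟨a, b⟩ | ⟨a, b⟩
    · exact Or.inr ⟨by rw [← a, hP.pair_pair], by rw [← b, sub_sub_cancel]⟩
    · exact Or.inl ⟨P.pair.injective a, by linear_combination -b⟩
  rw [doubleSide_of_nonneg h, doubleSide_of_nonneg h'] at he
  rcases hP.side_inj h h' (Or.inr h0) (Or.inr h0') h1 h1' (by rw [abs_lt]; constructor <;> linarith)
    he with ⟨a, b⟩ | ⟨a, b, -⟩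
  · exact Or.inl ⟨a, b⟩
  · exact Or.inr ⟨a, b⟩

end IsSurface
end PolygonGluing
end CosetComplex

/-! ### Coordinates around a vertex -/

namespace CosetComplex
-- For `u = ζ ^ (2/d)` on any branch, `|u| = |ζ| ^ (2/d)`: the choice of the corner `m` changes only
-- the argument.
theorem norm_exp_lt_iff {d : ℕ} (hd : 0 < d) {ζ : ℂ} (h0 : ζ ≠ 0) (m : ℤ) {r : ℝ} (hr : 0 < r) :
    ‖Complex.exp (2 / d * (Complex.log ζ + m * Real.pi * Complex.I))‖ <
      Real.exp (2 / d * Real.log r) ↔ ‖ζ‖ < r := by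
  have hd' : 0 < (2 / d : ℝ) := by positivity
  rw [Complex.norm_exp, Real.exp_lt_exp, show (2 / d : ℂ) = ((2 / d : ℝ) : ℂ) by push_cast; rfl,
    Complex.re_ofReal_mul, mul_lt_mul_iff_right₀ hd']
  simp only [Complex.add_re, Complex.log_re, Complex.mul_re, Complex.intCast_re, Complex.ofReal_re,
    Complex.intCast_im, Complex.ofReal_im, Complex.I_re, Complex.I_im, mul_zero, zero_mul, sub_zero,
    Complex.mul_im, add_zero]
  rw [Real.log_lt_log_iff (norm_pos_iff.2 h0) hr]

namespace PolygonGluing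

variable {J F D V : Type*} {P : PolygonGluing J F D V}

/-- The half planes around the start vertex of `δ` in logarithmic coordinates. -/
noncomputable def logFan (P : PolygonGluing J F D V) (δ : D) (w : ℂ) : J :=
  P.side ((P.rotate ^ ⌊w.im / Real.pi⌋) δ) (Complex.exp (w - ⌊w.im / Real.pi⌋ * Real.pi * Complex.I))

/-- The number of corners at a vertex. -/
noncomputable def degree (P : PolygonGluing J F D V) (v : V) : ℕ :=
  MulAction.period P.rotate (P.base v)

/-- The parametrization of a neighbourhood of a vertex `v`. -/
noncomputable def fan (P : PolygonGluing J F D V) (v : V) (u : ℂ) : J :=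
  if u = 0 then P.side (P.base v) 0 else P.logFan (P.base v) (P.degree v / 2 * Complex.log u)

theorem degree_pos [Finite D] (v : V) : 0 < P.degree v :=
  MulAction.period_pos_of_orderOf_pos (orderOf_pos _) _

theorem rotate_zpow_base_eq_iff (v : V) (m m' : ℤ) :
    (P.rotate ^ m) (P.base v) = (P.rotate ^ m') (P.base v) ↔ ∃ j : ℤ, m = m' + P.degree v * j := by
  have : (P.rotate ^ m) (P.base v) = (P.rotate ^ m') (P.base v) ↔
      P.rotate ^ (m - m') • P.base v = P.base v := by
    rw [sub_eq_neg_add, zpow_add, mul_smul, zpow_neg, inv_smul_eq_iff]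
    rfl
  rw [this, MulAction.zpow_smul_eq_iff_period_dvd]
  exact exists_congr fun j => by rw [degree, sub_eq_iff_eq_add']

theorem logFan_add (δ : D) (w : ℂ) (k : ℤ) :
    P.logFan δ (w + k * Real.pi * Complex.I) = P.logFan ((P.rotate ^ k) δ) w := by
  have : (w + k * Real.pi * Complex.I).im / Real.pi = w.im / Real.pi + k := by
    have := Real.pi_ne_zero
    simp
    field_simp
  rw [logFan, logFan, this, Int.floor_add_intCast, zpow_add, Equiv.Perm.mul_apply]
  congr 2
  push_cast; ring

/-- The ambiguity `2πik` of the logarithm becomes `d k π i` after scaling by `d/2`, hence `d k`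
rotations, and these fix the base dart because `d` is its period. -/
theorem fan_exp [Finite D] (v : V) (w : ℂ) :
    P.fan v (Complex.exp (2 / P.degree v * w)) = P.logFan (P.base v) w := by
  have hd : (P.degree v : ℂ) ≠ 0 := by exact_mod_cast (degree_pos v).ne'
  have he := Complex.exp_log (Complex.exp_ne_zero (2 / P.degree v * w))
  rw [Complex.exp_eq_exp_iff_exists_int] at he
  obtain ⟨k, hk⟩ := he
  rw [fan, if_neg (Complex.exp_ne_zero _), hk]
  have : (P.degree v / 2 * (2 / P.degree v * w + k * (2 * Real.pi * Complex.I)) : ℂ) =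
      w + ((P.degree v * k : ℤ) : ℂ) * Real.pi * Complex.I := by
    push_cast; field_simp
  rw [this, logFan_add]
  congr 1
  have := (rotate_zpow_base_eq_iff (P := P) v (P.degree v * k) 0).2 ⟨k, by simp⟩
  simpa using this

namespace IsSurface

variable [TopologicalSpace J] (hP : P.IsSurface)
include hP

/-- The jump of the floor function at `im w = kπ` is harmless: the two strips next to this line are
the two half planes of the `k`-th dart, the lower one by `side_rotate`. -/
theorem logFan_eq (δ : D) (w : ℂ) (k : ℤ) (h : (k - 1) * Real.pi < w.im)
    (h' : w.im < (k + 1) * Real.pi) :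
    P.logFan δ w = P.doubleSide ((P.rotate ^ k) δ) (Complex.exp (w - k * Real.pi * Complex.I)) := by
  have hpi := Real.pi_pos
  have him : (Complex.exp (w - k * Real.pi * Complex.I)).im =
      Real.exp w.re * Real.sin (w.im - k * Real.pi) := by
    simp [Complex.exp_im]
  rcases le_or_gt (k * Real.pi) w.im with hk | hk
  · have : ⌊w.im / Real.pi⌋ = k := by
      rw [Int.floor_eq_iff, le_div_iff₀ hpi, div_lt_iff₀ hpi]
      exact ⟨hk, h'⟩
    rw [logFan, this, doubleSide_of_nonneg]
    rw [him]
    exact mul_nonneg (Real.exp_pos _).le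
      (Real.sin_nonneg_of_nonneg_of_le_pi (by linarith) (by linarith))
  · have : ⌊w.im / Real.pi⌋ = k - 1 := by
      rw [Int.floor_eq_iff, le_div_iff₀ hpi, div_lt_iff₀ hpi]
      push_cast
      exact ⟨h.le, by simpa using hk⟩
    have hs : (Complex.exp (w - k * Real.pi * Complex.I)).im < 0 := by
      rw [him]
      exact mul_neg_of_pos_of_neg (Real.exp_pos _)
        (Real.sin_neg_of_neg_of_neg_pi_lt (by linarith) (by linarith))
    rw [logFan, this, doubleSide, if_neg (not_le.2 hs)]
    have hk : (P.rotate ^ k) δ = P.rotate ((P.rotate ^ (k - 1)) δ) := by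
      rw [← Equiv.Perm.mul_apply, ← zpow_one_add, add_sub_cancel]
    rw [hk, hP.side_rotate]
    congr 1
    rw [show (w - ((k - 1 : ℤ) : ℂ) * Real.pi * Complex.I) =
      w - k * Real.pi * Complex.I + Real.pi * Complex.I by push_cast; ring, Complex.exp_add,
      Complex.exp_pi_mul_I]
    ring

variable [Finite D]

/-- Away from its centre, the parametrization of a neighbourhood of a vertex is locally a
holomorphic change of coordinates away from a doubled half plane. -/
theorem exists_chartRel_fan (v : V) {u : ℂ} (hu : u ≠ 0) : ∃ (m : ℤ) (ζ : ℂ), 0 ≤ ζ.im ∧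
    ζ ∈ Complex.slitPlane ∧ P.fan v u = P.side ((P.rotate ^ m) (P.base v)) ζ ∧
    u = Complex.exp (2 / P.degree v * (Complex.log ζ + m * Real.pi * Complex.I)) ∧
    ChartRel (P.fan v) (P.doubleSide ((P.rotate ^ m) (P.base v))) u ζ := by
  have hpi := Real.pi_pos
  have hd : (P.degree v : ℂ) ≠ 0 := by exact_mod_cast (degree_pos v).ne'
  obtain ⟨w, rfl⟩ : ∃ w, Complex.exp (2 / P.degree v * w) = u :=
    ⟨P.degree v / 2 * Complex.log u, by
      rw [← Complex.exp_log hu]; congr 1; rw [Complex.exp_log hu]; field_simp⟩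
  set m := ⌊w.im / Real.pi⌋ with hm
  have h1 : m * Real.pi ≤ w.im := by rw [← le_div_iff₀ hpi]; exact Int.floor_le _
  have h2 : w.im < (m + 1) * Real.pi := by rw [← div_lt_iff₀ hpi]; exact Int.lt_floor_add_one _
  set v' := w - m * Real.pi * Complex.I with hv'
  have hv'im : v'.im = w.im - m * Real.pi := by simp [hv']
  have hlog : Complex.log (Complex.exp v') = v' := Complex.log_exp (by linarith) (by linarith)
  have hslit : Complex.exp v' ∈ Complex.slitPlane := by
    rw [Complex.mem_slitPlane_iff_arg]
    refine ⟨?_, Complex.exp_ne_zero _⟩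
    rw [← Complex.log_im, hlog]
    linarith
  have him : 0 ≤ (Complex.exp v').im := by
    rw [Complex.exp_im]
    exact mul_nonneg (Real.exp_pos _).le
      (Real.sin_nonneg_of_nonneg_of_le_pi (by linarith) (by linarith))
  have hh : Complex.exp (2 / P.degree v * w) =
      Complex.exp (2 / P.degree v * (Complex.log (Complex.exp v') + m * Real.pi * Complex.I)) := by
    rw [hlog, hv', sub_add_cancel]
  refine ⟨m, Complex.exp v', him, hslit, ?_, hh, ?_⟩
  · rw [fan_exp, hP.logFan_eq _ _ m (by linarith) h2, doubleSide_of_nonneg him]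
  · obtain ⟨s, hs1, hs2, hs3⟩ := exists_analyticAt_exp_eq (w := w)
      (div_ne_zero two_ne_zero hd : (2 / P.degree v : ℂ) ≠ 0)
    refine ⟨fun z => Complex.exp (s z - m * Real.pi * Complex.I), fun ζ => Complex.exp
      (2 / P.degree v * (Complex.log ζ + m * Real.pi * Complex.I)), ?_, ?_, ?_, hh.symm, ?_, ?_⟩
    · exact (hs1.sub analyticAt_const).cexp
    · exact (analyticAt_const.mul ((analyticAt_clog hslit).add analyticAt_const)).cexp
    · simp only [hs2, hv']
    · have hc : ContinuousAt (fun z => (s z).im) (Complex.exp (2 / P.degree v * w)) :=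
        Complex.continuous_im.continuousAt.comp hs1.continuousAt
      have e1 : ∀ᶠ z in 𝓝 (Complex.exp (2 / P.degree v * w)), (m - 1) * Real.pi < (s z).im :=
        hc.eventually (lt_mem_nhds (by simp only [hs2]; linarith))
      have e2 : ∀ᶠ z in 𝓝 (Complex.exp (2 / P.degree v * w)), (s z).im < (m + 1) * Real.pi :=
        hc.eventually (gt_mem_nhds (by simpa only [hs2] using h2))
      filter_upwards [hs3, e1, e2] with z hz h3 h4
      rw [← hP.logFan_eq _ _ m h3 h4, ← fan_exp, hz]
    · filter_upwards [Complex.isOpen_slitPlane.mem_nhds hslit] with ζ hζ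
      have ha := (Complex.mem_slitPlane_iff_arg.1 hζ).1
      have hb := Complex.neg_pi_lt_arg ζ
      have hc := (Complex.arg_le_pi ζ).lt_of_ne ha
      rw [fan_exp, hP.logFan_eq _ _ m]
      · rw [add_sub_cancel_right, Complex.exp_log (Complex.slitPlane_ne_zero hζ)]
      · simp [Complex.log_im]; linarith
      · simp [Complex.log_im]; linarith

/-- A whole closed corner lies in the fan. Its ray `arg ζ = π` already belongs to corner `m + 1`;
there the gluing along the next dart is used, and `‖ζ‖ ≤ 1` keeps the parameter in `[0, 1]`. -/
theorem side_eq_fan (v : V) (m : ℤ) {ζ : ℂ} (h : 0 ≤ ζ.im) (h0 : ζ ≠ 0) (h1 : ‖ζ‖ ≤ 1) :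
    P.side ((P.rotate ^ m) (P.base v)) ζ =
      P.fan v (Complex.exp (2 / P.degree v * (Complex.log ζ + m * Real.pi * Complex.I))) := by
  have hpi := Real.pi_pos
  have ha := Complex.arg_nonneg_iff.2 h
  rw [fan_exp]
  rcases (Complex.arg_le_pi ζ).lt_or_eq with hlt | heq
  · rw [hP.logFan_eq _ _ m (by simp [Complex.log_im]; linarith)
      (by simp [Complex.log_im]; linarith), add_sub_cancel_right,
      Complex.exp_log h0, doubleSide_of_nonneg h]
  · obtain ⟨hr, hi⟩ := Complex.arg_eq_pi_iff.1 heq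
    have e : ζ = (ζ.re : ℂ) := Complex.ext rfl (by simp [hi])
    have hm : (P.rotate ^ (m + 1)) (P.base v) = P.rotate ((P.rotate ^ m) (P.base v)) := by
      rw [← Equiv.Perm.mul_apply, ← zpow_one_add, add_comm]
    rw [hP.logFan_eq _ _ (m + 1) (by simp [Complex.log_im, heq]; linarith)
      (by simp [Complex.log_im, heq]; linarith), hm]
    rw [show (Complex.log ζ + m * Real.pi * Complex.I - ((m + 1 : ℤ) : ℂ) * Real.pi * Complex.I) =
      Complex.log ζ - Real.pi * Complex.I by push_cast; ring, Complex.exp_sub,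
      Complex.exp_pi_mul_I, Complex.exp_log h0, div_neg, div_one,
      doubleSide_of_nonneg (by simp [hi])]
    have h2 := hP.side_rotate ((P.rotate ^ m) (P.base v)) (-ζ)
    rw [neg_neg] at h2
    have hn : |ζ.re| ≤ 1 := (Complex.abs_re_le_norm ζ).trans h1
    rw [← h2, e, ← Complex.ofReal_neg, hP.glue _ (-ζ.re) (by linarith)
      (by linarith [neg_abs_le ζ.re])]

end IsSurface

/-- The radius of the disc that parametrizes a neighbourhood of a vertex. -/
noncomputable def radius (P : PolygonGluing J F D V) (v : V) : ℝ :=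
  Real.exp (2 / P.degree v * Real.log (1 / 2))

end PolygonGluing
end CosetComplex

/-! ### The atlas of a glued surface and the Hausdorff property -/

namespace CosetComplex

theorem ChartRel.continuousAt {J : Type*} [TopologicalSpace J] {φ χ : ℂ → J} {a b : ℂ}
    (H : ChartRel φ χ a b) (h : ContinuousAt χ b) : ContinuousAt φ a := by
  obtain ⟨g, -, hg, -, rfl, -, h1, -⟩ := H
  exact (ContinuousAt.comp h hg.continuousAt).congr h1

namespace PolygonGluing

variable {J F D V : Type*} {P : PolygonGluing J F D V}

/-- The domains of the parametrizations by faces, edges and vertices. -/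
def chartDomain (P : PolygonGluing J F D V) : F ⊕ D ⊕ V → Set ℂ
  | .inl _ => {z | ‖z‖ < 1}
  | .inr (.inl _) => {ζ | 0 < ζ.re ∧ ζ.re < 1}
  | .inr (.inr v) => {u | ‖u‖ < P.radius v}

/-- The parametrizations by faces, edges and vertices. -/
noncomputable def chartMap (P : PolygonGluing J F D V) : F ⊕ D ⊕ V → ℂ → J
  | .inl f => P.disc f
  | .inr (.inl δ) => P.doubleSide δ
  | .inr (.inr v) => P.fan v

/-- At `a`, the map `φ` is a coordinate change away from the interior of a face. -/
def IsInterior (P : PolygonGluing J F D V) (φ : ℂ → J) (a : ℂ) : Prop :=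
  ∃ f z, ‖z‖ < 1 ∧ ChartRel φ (P.disc f) a z

/-- At `a`, the map `φ` is a coordinate change away from an inner point of an edge. -/
def IsEdge (P : PolygonGluing J F D V) (φ : ℂ → J) (a : ℂ) : Prop :=
  ∃ δ, ∃ t : ℝ, 0 < t ∧ t < 1 ∧ ChartRel φ (P.doubleSide δ) a t

theorem isOpen_chartDomain (c : F ⊕ D ⊕ V) : IsOpen (P.chartDomain c) := by
  rcases c with f | δ | v
  · exact isOpen_lt continuous_norm continuous_const
  · exact (isOpen_lt continuous_const Complex.continuous_re).inter
      (isOpen_lt Complex.continuous_re continuous_const)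
  · exact isOpen_lt continuous_norm continuous_const

theorem radius_pos (v : V) : 0 < P.radius v := Real.exp_pos _

theorem isEdge_doubleSide {δ : D} {ζ : ℂ} (h : ζ.im = 0) (h0 : 0 < ζ.re) (h1 : ζ.re < 1) :
    P.IsEdge (P.doubleSide δ) ζ := by
  refine ⟨δ, ζ.re, h0, h1, ?_⟩
  rw [show ((ζ.re : ℝ) : ℂ) = ζ from Complex.ext rfl (by simp [h])]
  exact ChartRel.refl _ _

theorem fan_zero (v : V) : P.fan v 0 = P.side (P.base v) 0 := if_pos rfl

namespace IsSurface

variable [TopologicalSpace J] (hP : P.IsSurface)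
include hP

theorem chartRel_doubleSide_pair {δ : D} {ζ : ℂ} (h : ζ.im ≠ 0 ∨ (0 < ζ.re ∧ ζ.re < 1)) :
    ChartRel (P.doubleSide δ) (P.doubleSide (P.pair δ)) ζ (1 - ζ) := by
  have key : ∀ {δ : D} {ζ : ℂ}, (ζ.im ≠ 0 ∨ (0 < ζ.re ∧ ζ.re < 1)) →
      ∀ᶠ w in 𝓝 ζ, P.doubleSide (P.pair δ) (1 - w) = P.doubleSide δ w := by
    intro δ ζ h
    have ho : IsOpen {w : ℂ | w.im ≠ 0 ∨ (0 < w.re ∧ w.re < 1)} :=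
      (isOpen_ne_fun Complex.continuous_im continuous_const).union
        ((isOpen_lt continuous_const Complex.continuous_re).inter
          (isOpen_lt Complex.continuous_re continuous_const))
    filter_upwards [ho.mem_nhds h] with w hw
    exact hP.doubleSide_pair (hw.imp_right fun h => ⟨h.1.le, h.2.le⟩)
  refine ⟨fun w => 1 - w, fun w => 1 - w, by fun_prop, by fun_prop, rfl, by simp, key h, ?_⟩
  have := key (δ := P.pair δ) (ζ := 1 - ζ) (by
    rcases h with h | h
    · exact Or.inl (by simpa using h)
    · exact Or.inr ⟨by simp; linarith, by simp; linarith⟩)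
  simpa only [hP.pair_pair] using this

theorem isInterior_doubleSide {δ : D} {ζ : ℂ} (h : ζ.im ≠ 0) :
    P.IsInterior (P.doubleSide δ) ζ := by
  wlog hpos : 0 < ζ.im generalizing δ ζ
  · have hneg : ζ.im < 0 := lt_of_le_of_ne (not_lt.1 hpos) h
    obtain ⟨f, z, hz, hr⟩ := this (δ := P.pair δ) (ζ := 1 - ζ) (by simpa using h)
      (by simpa using hneg)
    exact ⟨f, z, hz, (hP.chartRel_doubleSide_pair (Or.inl h)).trans hr⟩
  obtain ⟨-, -, -, -, hr⟩ := chartRel_disc_side (hP.sides_pos (P.face δ)) ζ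
  refine ⟨_, _, (norm_discParam_lt_one (hP.sides_pos _)).2 (by simpa), ChartRel.trans
    (ChartRel.of_eventuallyEq ?_) hr.symm⟩
  filter_upwards [(isOpen_lt continuous_const Complex.continuous_im).mem_nhds hpos] with w hw
  exact (doubleSide_of_nonneg (le_of_lt hw)).symm

theorem chartRel_of_isInterior {φ χ : ℂ → J} {a b : ℂ} (h : P.IsInterior φ a)
    (h' : P.IsInterior χ b) (he : φ a = χ b) : ChartRel φ χ a b := by
  obtain ⟨f, z, hz, hr⟩ := h
  obtain ⟨f', z', hz', hr'⟩ := h'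
  rw [hr.apply_eq, hr'.apply_eq] at he
  obtain ⟨rfl, rfl⟩ := hP.disc_inj _ _ _ _ hz hz' he
  exact hr.trans hr'.symm

theorem chartRel_of_isEdge {φ χ : ℂ → J} {a b : ℂ} (h : P.IsEdge φ a)
    (h' : P.IsEdge χ b) (he : φ a = χ b) : ChartRel φ χ a b := by
  obtain ⟨δ, t, h0, h1, hr⟩ := h
  obtain ⟨δ', t', h0', h1', hr'⟩ := h'
  rw [hr.apply_eq, hr'.apply_eq] at he
  rcases hP.doubleSide_inj (by simpa) (by simpa) (by simpa) (by simpa) he with ⟨rfl, ht⟩ | ⟨rfl, ht⟩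
  · rw [ht] at hr'
    exact hr.trans hr'.symm
  · rw [ht] at hr'
    exact hr.trans ((hP.chartRel_doubleSide_pair (Or.inr (by simpa using ⟨h0, h1⟩))).trans hr'.symm)

/-- The values of `γ` distinguish the three kinds of points: first component below 1 inside a face,
first component 1 and second nonzero on an open edge, `(1, 0)` at a vertex. -/
theorem exists_level_kind : ∃ γ : J → ℝ × ℝ, Continuous γ ∧
    (∀ f z, ‖z‖ ≤ 1 → (γ (P.disc f z)).1 = ‖z‖) ∧
    (∀ φ a, P.IsInterior φ a → (γ (φ a)).1 < 1) ∧
    (∀ φ a, P.IsEdge φ a → (γ (φ a)).1 = 1 ∧ (γ (φ a)).2 ≠ 0) ∧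
    (∀ δ, γ (P.side δ 0) = (1, 0)) ∧
    ∀ δ, ∀ t : ℝ, 0 ≤ t → t < 1 → (γ (P.side δ t)).2 = 0 → t = 0 := by
  obtain ⟨γ, h1, h2, h3, h4, h5⟩ := hP.exists_level_side
  have h6 : ∀ δ, ∀ t : ℝ, 0 ≤ t → t < 1 → (γ (P.side δ t)).2 = 0 → t = 0 := by
    intro δ t h0 ht h
    obtain ⟨m, rfl⟩ := (h5 δ t).1 h
    have a : 0 ≤ m := by exact_mod_cast h0
    have b : m < 1 := by exact_mod_cast ht
    have : m = 0 := by omega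
    simp [this]
  refine ⟨γ, h1, fun f z hz => by rw [h2 f z hz], ?_, ?_, ?_, h6⟩
  · rintro φ a ⟨f, z, hz, hr⟩
    rw [hr.apply_eq, h2 f z hz.le]
    exact hz
  · rintro φ a ⟨δ, t, ht0, ht1, hr⟩
    rw [hr.apply_eq, doubleSide_of_nonneg (by simp)]
    exact ⟨h4 _ _, fun h => ht0.ne' (h6 _ _ ht0.le ht1 h)⟩
  · intro δ
    have a := h4 δ 0
    have b := (h5 δ 0).2 ⟨0, by simp⟩
    rw [Complex.ofReal_zero] at a b
    exact Prod.ext a b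

theorem vert_rotate_zpow (δ : D) (m : ℤ) : P.vert ((P.rotate ^ m) δ) = P.vert δ :=
  hP.vert_eq _ _ (hP.side_rotate_zpow_zero δ m)

/-- Every point is in the interior of a face, or an inner point of an edge, or a vertex. -/
theorem exists_chart (p : J) : (∃ f z, ‖z‖ < 1 ∧ P.disc f z = p) ∨
    (∃ δ, ∃ t : ℝ, 0 < t ∧ t < 1 ∧ P.doubleSide δ t = p) ∨ ∃ v, P.fan v 0 = p := by
  obtain ⟨f, z, hz, rfl⟩ := hP.disc_surj p
  rcases hz.lt_or_eq with h | h
  · exact Or.inl ⟨f, z, h, rfl⟩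
  right
  obtain ⟨δ, ζ, rfl, rfl, h0, h1⟩ := hP.exists_side_eq (f := f) (z := z)
    (by rw [← norm_ne_zero_iff, h]; exact one_ne_zero)
  have hi : 0 ≤ ζ.im := by simpa using (norm_discParam_le_one (hP.sides_pos _)).1 h.le
  have hi' : ¬ 0 < ζ.im := by
    simpa using mt (norm_discParam_lt_one (hP.sides_pos _)).2 h.not_lt
  have hζ : ζ = (ζ.re : ℂ) := Complex.ext rfl (by simp; linarith)
  rcases h0.lt_or_eq with h0 | h0
  · refine Or.inl ⟨δ, ζ.re, h0, h1, ?_⟩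
    rw [← hζ, doubleSide_of_nonneg hi]
    rfl
  · right
    obtain ⟨m, hm⟩ := hP.exists_rotate δ
    refine ⟨P.vert δ, ?_⟩
    rw [fan_zero, ← hP.side_rotate_zpow_zero _ m, ← hm, side, hζ, ← h0, Complex.ofReal_zero]

theorem exists_chartMap_eq (p : J) : ∃ c, ∃ z ∈ P.chartDomain c, P.chartMap c z = p := by
  rcases hP.exists_chart p with ⟨f, z, h, e⟩ | ⟨δ, t, h0, h1, e⟩ | ⟨v, e⟩
  · exact ⟨.inl f, z, h, e⟩
  · exact ⟨.inr (.inl δ), t, ⟨by simpa, by simpa⟩, e⟩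
  · exact ⟨.inr (.inr v), 0, by simpa [chartDomain] using radius_pos v, e⟩

variable [Finite D]

theorem exists_fan_eq (v : V) {u : ℂ} (hu : u ≠ 0) (hu' : ‖u‖ < P.radius v) : ∃ (m : ℤ) (ζ : ℂ),
    0 ≤ ζ.im ∧ (0 < ζ.im ∨ 0 < ζ.re) ∧ |ζ.re| < 1 / 2 ∧
    P.fan v u = P.side ((P.rotate ^ m) (P.base v)) ζ ∧
    u = Complex.exp (2 / P.degree v * (Complex.log ζ + m * Real.pi * Complex.I)) ∧
    ChartRel (P.fan v) (P.doubleSide ((P.rotate ^ m) (P.base v))) u ζ := by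
  obtain ⟨m, ζ, h1, h2, h3, h4, h5⟩ := hP.exists_chartRel_fan v hu
  refine ⟨m, ζ, h1, ?_, ?_, h3, h4, h5⟩
  · rcases h2 with h | h
    · exact Or.inr h
    · exact Or.inl (h1.lt_of_ne' h)
  -- The radius is `(1/2) ^ (2/d)`, so that `‖ζ‖ < 1/2`. Real parts of two such points differ by
  -- less than 1, as `side_inj` requires.
  · rw [h4, radius, norm_exp_lt_iff (degree_pos v) (Complex.slitPlane_ne_zero h2) _
      (by norm_num)] at hu'
    exact (Complex.abs_re_le_norm ζ).trans_lt hu'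

/-- Each chart is compared at each point with a standard one for the kind of that point. This
replaces a comparison of all pairs of charts. -/
theorem chart_kind (c : F ⊕ D ⊕ V) {a : ℂ} (ha : a ∈ P.chartDomain c) :
    P.IsInterior (P.chartMap c) a ∨ P.IsEdge (P.chartMap c) a ∨ ∃ v, c = .inr (.inr v) ∧ a = 0 := by
  rcases c with f | δ | v
  · exact Or.inl ⟨f, a, ha, ChartRel.refl _ _⟩
  · by_cases h : a.im = 0
    · exact Or.inr (Or.inl (isEdge_doubleSide h ha.1 ha.2))
    · exact Or.inl (hP.isInterior_doubleSide h)
  · by_cases h : a = 0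
    · exact Or.inr (Or.inr ⟨v, rfl, h⟩)
    obtain ⟨m, ζ, h1, h2, h3, -, -, hr⟩ := hP.exists_fan_eq v h ha
    rw [abs_lt] at h3
    by_cases hi : ζ.im = 0
    · obtain ⟨δ, t, h0, h1, hr'⟩ := isEdge_doubleSide (δ := (P.rotate ^ m) (P.base v)) hi
        (h2.resolve_left (by simp [hi])) (by linarith)
      exact Or.inr (Or.inl ⟨δ, t, h0, h1, hr.trans hr'⟩)
    · obtain ⟨f, z, hz, hr'⟩ := hP.isInterior_doubleSide (δ := (P.rotate ^ m) (P.base v)) hi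
      exact Or.inl ⟨f, z, hz, hr.trans hr'⟩

theorem fan_inj {v v' : V} {u u' : ℂ} (hu : ‖u‖ < P.radius v) (hu' : ‖u'‖ < P.radius v')
    (he : P.fan v u = P.fan v' u') : v = v' ∧ u = u' := by
  obtain ⟨γ, -, -, g1, g2, g3, -⟩ := hP.exists_level_kind
  have aux : ∀ {v v' : V} {u : ℂ}, ‖u‖ < P.radius v → P.fan v u = P.side (P.base v') 0 →
      u = 0 := by
    intro v v' u hu he
    rcases hP.chart_kind (.inr (.inr v)) (a := u) hu with h | h | ⟨-, -, h⟩
    · have := g1 _ _ h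
      simp [chartMap, he, g3] at this
    · have := (g2 _ _ h).2
      simp [chartMap, he, g3] at this
    · exact h
  by_cases h : u = 0
  · subst h
    rw [fan_zero] at he
    obtain rfl := aux hu' he.symm
    rw [fan_zero] at he
    exact ⟨by simpa only [hP.vert_base] using hP.vert_eq _ _ he, rfl⟩
  by_cases h' : u' = 0
  · subst h'
    rw [fan_zero] at he
    exact absurd (aux hu he) h
  obtain ⟨m, ζ, h1, h2, h3, h4, h5, -⟩ := hP.exists_fan_eq v h hu
  obtain ⟨m', ζ', h1', h2', h3', h4', h5', -⟩ := hP.exists_fan_eq v' h' hu'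
  rw [abs_lt] at h3 h3'
  rw [h4, h4'] at he
  rcases hP.side_inj h1 h1' h2 h2' (by linarith) (by linarith)
    (by rw [abs_lt]; constructor <;> linarith) he with ⟨a, rfl⟩ | ⟨-, b, -⟩
  · have hv := congrArg P.vert a
    rw [hP.vert_rotate_zpow, hP.vert_rotate_zpow, hP.vert_base, hP.vert_base] at hv
    subst hv
    refine ⟨rfl, ?_⟩
    -- Equal darts have indices that differ by a multiple of the degree, so the arguments of `u` and
    -- `u'` differ by a multiple of `2π`.
    obtain ⟨j, rfl⟩ := (rotate_zpow_base_eq_iff _ _ _).1 a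
    have hd : (P.degree v' : ℂ) ≠ 0 := by exact_mod_cast (degree_pos v').ne'
    rw [h5, h5', Complex.exp_eq_exp_iff_exists_int]
    refine ⟨-j, ?_⟩
    push_cast
    field_simp
    ring
  -- The flipped case `ζ' = 1 - ζ` is impossible, as both real parts are below `1/2`.
  · have := congrArg Complex.re b
    simp at this
    linarith

/-- The level function forces both charts to see the point as the same kind; relations to the
standard charts then compose. At a vertex the two charts coincide. -/
theorem chartRel_chartMap (c c' : F ⊕ D ⊕ V) (a b : ℂ) (ha : a ∈ P.chartDomain c)
    (hb : b ∈ P.chartDomain c') (he : P.chartMap c a = P.chartMap c' b) :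
    ChartRel (P.chartMap c) (P.chartMap c') a b := by
  obtain ⟨γ, -, -, g1, g2, g3, -⟩ := hP.exists_level_kind
  have g4 : ∀ v, γ (P.chartMap (.inr (.inr v)) 0) = (1, 0) := fun v => by
    rw [chartMap, fan_zero, g3]
  rcases hP.chart_kind c ha with h | h | ⟨v, rfl, rfl⟩ <;>
  rcases hP.chart_kind c' hb with h' | h' | ⟨v', rfl, rfl⟩
  · exact hP.chartRel_of_isInterior h h' he
  · have := g1 _ _ h
    rw [he, (g2 _ _ h').1] at this
    exact absurd this (lt_irrefl _)
  · have := g1 _ _ h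
    rw [he, g4] at this
    exact absurd this (lt_irrefl _)
  · have := g1 _ _ h'
    rw [← he, (g2 _ _ h).1] at this
    exact absurd this (lt_irrefl _)
  · exact hP.chartRel_of_isEdge h h' he
  · have := (g2 _ _ h).2
    rw [he, g4] at this
    exact absurd rfl this
  · have := g1 _ _ h'
    rw [← he, g4] at this
    exact absurd this (lt_irrefl _)
  · have := (g2 _ _ h').2
    rw [← he, g4] at this
    exact absurd rfl this
  · obtain ⟨rfl, -⟩ := hP.fan_inj ha hb he
    exact ChartRel.refl _ _

theorem continuousAt_fan_zero (v : V) : ContinuousAt (P.fan v) 0 := by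
  rw [ContinuousAt, fan_zero]
  intro O hO
  -- There are finitely many darts, so one neighbourhood of 0 serves all corners.
  have : ∀ᶠ ζ in 𝓝 (0 : ℂ), ∀ δ, P.side δ 0 = P.side (P.base v) 0 → P.side δ ζ ∈ O := by
    rw [Filter.eventually_all]
    intro δ
    by_cases h : P.side δ 0 = P.side (P.base v) 0
    · have hc := (hP.continuous_side δ).continuousAt (x := 0)
      rw [ContinuousAt, h] at hc
      filter_upwards [hc hO] with ζ hζ _ using hζ
    · exact Eventually.of_forall fun ζ h' => absurd h' h
  obtain ⟨ε, hε, hball⟩ := Metric.eventually_nhds_iff.1 this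
  have hr : 0 < Real.exp (2 / P.degree v * Real.log ε) := Real.exp_pos _
  refine Metric.eventually_nhds_iff.2 ⟨_, hr, fun u hu => ?_⟩
  rw [dist_zero_right] at hu
  by_cases h0 : u = 0
  · rw [h0, fan_zero]
    exact mem_of_mem_nhds hO
  obtain ⟨m, ζ, h1, h2, h3, h4, -⟩ := hP.exists_chartRel_fan v h0
  rw [h4, norm_exp_lt_iff (degree_pos v) (Complex.slitPlane_ne_zero h2) _ hε] at hu
  rw [h3]
  exact hball (by simpa using hu) _ (hP.side_rotate_zpow_zero _ _)

theorem continuousOn_chartMap (c : F ⊕ D ⊕ V) :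
    ContinuousOn (P.chartMap c) (P.chartDomain c) := by
  intro a ha
  refine ContinuousAt.continuousWithinAt ?_
  rcases hP.chart_kind c ha with ⟨f, z, -, hr⟩ | ⟨δ, t, h0, h1, hr⟩ | ⟨v, rfl, rfl⟩
  · exact hr.continuousAt (hP.continuous_disc f).continuousAt
  · exact hr.continuousAt ((hP.continuousOn_doubleSide δ).continuousAt
      ((isOpen_chartDomain (P := P) (.inr (.inl δ))).mem_nhds ⟨by simpa, by simpa⟩))
  · exact hP.continuousAt_fan_zero v

/-- By `isOpen_of` it suffices to check openness in each closed disc. The three kinds of points use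
`ChartRel` with the disc, with the doubled half plane restricted to its upper half, and
`side_eq_fan`. -/
theorem isOpen_chartMap_image (c : F ⊕ D ⊕ V) (B : Set ℂ) (hB : B ⊆ P.chartDomain c)
    (hBo : IsOpen B) : IsOpen (P.chartMap c '' B) := by
  obtain ⟨γ, -, g0, g1, g2, g3, g4⟩ := hP.exists_level_kind
  refine hP.isOpen_of _ ?_
  rintro f z hz ⟨a, ha, he⟩
  have hlift : ∀ {φ : ℂ → J} {b : ℂ}, ChartRel φ (P.chartMap c) b a →
      ∀ᶠ w in 𝓝 b, φ w ∈ P.chartMap c '' B := by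
    rintro φ b ⟨g, -, hg, -, rfl, -, h1, -⟩
    filter_upwards [h1, hg.continuousAt.eventually_mem (hBo.mem_nhds ha)] with w hw hw'
    exact ⟨_, hw', hw⟩
  have hside : ‖z‖ = 1 → ∃ δ, ∃ t : ℝ, 0 ≤ t ∧ t < 1 ∧ P.side δ t = P.disc f z ∧ ∃ s : ℂ → ℂ,
      ContinuousAt s z ∧ s z = t ∧
      ∀ᶠ w in 𝓝 z, P.side δ (s w) = P.disc f w ∧ (‖w‖ ≤ 1 → 0 ≤ (s w).im) := by
    intro hz1
    obtain ⟨δ, ζ, rfl, rfl, h0, h1⟩ := hP.exists_side_eq (f := f) (z := z)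
      (by rw [← norm_ne_zero_iff, hz1]; exact one_ne_zero)
    obtain ⟨s, a1, a2, a3, -⟩ := chartRel_disc_side (hP.sides_pos (P.face δ)) ζ
    have hi : 0 ≤ ζ.im := by simpa using (norm_discParam_le_one (hP.sides_pos _)).1 hz1.le
    have hi' : ¬ 0 < ζ.im := by
      simpa using mt (norm_discParam_lt_one (hP.sides_pos _)).2 hz1.not_lt
    have hζ : ζ = (ζ.re : ℂ) := Complex.ext rfl (by simp; linarith)
    exact ⟨δ, ζ.re, h0, h1, by rw [← hζ]; rfl, s, a1.continuousAt, by rw [a2, ← hζ], a3⟩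
  rcases hP.chart_kind c (hB ha) with h | h | ⟨v, rfl, rfl⟩
  · have hz' := g1 _ _ h
    rw [he, g0 f z hz] at hz'
    filter_upwards [hlift (hP.chartRel_of_isInterior ⟨f, z, hz', ChartRel.refl _ _⟩ h he.symm)]
      with w hw _ using hw
  · have hz' := g2 _ _ h
    rw [he, g0 f z hz] at hz'
    obtain ⟨δ, t, h0, h1, e, s, s1, s2, s3⟩ := hside hz'.1
    rw [← e] at hz'
    have ht : 0 < t := h0.lt_of_ne fun ht => hz'.2 (by rw [← ht, Complex.ofReal_zero, g3])
    have hr := hP.chartRel_of_isEdge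
      (isEdge_doubleSide (δ := δ) (ζ := t) (by simp) (by simpa) (by simpa)) h
      (by rw [doubleSide_of_nonneg (by simp), e, he])
    rw [ContinuousAt, s2] at s1
    filter_upwards [s3, s1.eventually (hlift hr)] with w hw hw' hw1
    rw [doubleSide_of_nonneg (hw.2 hw1), hw.1] at hw'
    exact hw'
  · rw [chartMap, fan_zero] at he
    have hz1 := g0 f z hz
    rw [← he, g3] at hz1
    obtain ⟨δ, t, h0, h1, e, s, s1, s2, s3⟩ := hside hz1.symm
    obtain rfl := g4 δ t h0 h1 (by rw [e, ← he, g3])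
    rw [Complex.ofReal_zero] at e s2
    have hv : P.vert δ = v := by
      rw [hP.vert_eq δ (P.base v) (by rw [e, he]), hP.vert_base]
    obtain ⟨m, hm⟩ := hP.exists_rotate δ
    rw [hv] at hm
    obtain ⟨r, hr, hball⟩ := Metric.isOpen_iff.1 hBo 0 ha
    have hd : 0 < P.degree v := degree_pos v
    -- `ρ = r ^ (d/2)`: in side coordinates, `‖ζ‖ < ρ` corresponds to `‖u‖ < r`.
    set ρ := Real.exp (P.degree v / 2 * Real.log r) with hρ
    have hρr : Real.exp (2 / P.degree v * Real.log ρ) = r := by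
      rw [hρ, Real.log_exp, ← mul_assoc, div_mul_div_cancel₀ (by positivity),
        div_self two_ne_zero, one_mul, Real.exp_log hr]
    rw [ContinuousAt, s2] at s1
    filter_upwards [s3, s1.eventually (Metric.ball_mem_nhds 0 (Real.exp_pos _ : 0 < ρ)),
      s1.eventually (Metric.ball_mem_nhds 0 zero_lt_one)] with w hw hw1 hw2 hw3
    rw [dist_zero_right] at hw1 hw2
    by_cases hs : s w = 0
    · exact ⟨0, ha, by rw [← hw.1, hs, chartMap, fan_zero, he, e]⟩
    · refine ⟨_, hball ?_, (hP.side_eq_fan v m (hw.2 hw3) hs hw2.le).symm.trans (by rw [← hm, hw.1])⟩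
      rw [Metric.mem_ball, dist_zero_right]
      conv_rhs => rw [← hρr]
      rwa [norm_exp_lt_iff hd hs _ (Real.exp_pos _)]

theorem injOn_chartMap (c : F ⊕ D ⊕ V) : InjOn (P.chartMap c) (P.chartDomain c) := by
  rcases c with f | δ | v
  · exact fun a ha b hb he => (hP.disc_inj _ _ _ _ ha hb he).2
  · intro a ha b hb he
    rcases hP.doubleSide_inj ha.1 ha.2 hb.1 hb.2 he with ⟨-, h⟩ | ⟨h, -⟩
    · exact h.symm
    · exact absurd h.symm (hP.pair_ne δ)
  · exact fun a ha b hb he => (hP.fan_inj ha hb he).2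

theorem separated_of_charts {c c' : F ⊕ D ⊕ V} {a b : ℂ} (ha : a ∈ P.chartDomain c)
    (hb : b ∈ P.chartDomain c') (hne : P.chartMap c a ≠ P.chartMap c' b)
    (h : c = c' ∨ Disjoint (P.chartMap c '' P.chartDomain c)
      (P.chartMap c' '' P.chartDomain c')) :
    ∃ O O' : Set J, IsOpen O ∧ IsOpen O' ∧ P.chartMap c a ∈ O ∧ P.chartMap c' b ∈ O' ∧
      Disjoint O O' := by
  rcases h with rfl | h
  · obtain ⟨B, B', h1, h2, h3, h4, h5⟩ := t2_separation (fun h => hne (by rw [h]) : a ≠ b)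
    have hd := isOpen_chartDomain (P := P) c
    refine ⟨P.chartMap c '' (B ∩ P.chartDomain c), P.chartMap c '' (B' ∩ P.chartDomain c),
      hP.isOpen_chartMap_image _ _ inter_subset_right (h1.inter hd),
      hP.isOpen_chartMap_image _ _ inter_subset_right (h2.inter hd),
      mem_image_of_mem _ ⟨h3, ha⟩, mem_image_of_mem _ ⟨h4, hb⟩, ?_⟩
    exact (h5.mono inter_subset_left inter_subset_left).image (hP.injOn_chartMap c)
      inter_subset_right inter_subset_right
  · exact ⟨_, _, hP.isOpen_chartMap_image _ _ subset_rfl (isOpen_chartDomain _),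
      hP.isOpen_chartMap_image _ _ subset_rfl (isOpen_chartDomain _),
      mem_image_of_mem _ ha, mem_image_of_mem _ hb, h⟩

/-- Points on different levels are separated by `γ`. Points on the same level are of the same kind,
so they lie in one chart or in two charts with disjoint images. -/
theorem t2Space : T2Space J := by
  refine ⟨fun p p' hne => ?_⟩
  obtain ⟨γ, gc, -, g1, g2, g3, -⟩ := hP.exists_level_kind
  by_cases hγ : γ p = γ p'
  swap
  · exact separated_by_continuous gc hγ
  have e1 : ∀ f z, ‖z‖ < 1 → (γ (P.disc f z)).1 < 1 := fun f z h =>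
    g1 _ _ ⟨f, z, h, ChartRel.refl _ _⟩
  have e2 : ∀ δ, ∀ t : ℝ, 0 < t → t < 1 →
      (γ (P.doubleSide δ t)).1 = 1 ∧ (γ (P.doubleSide δ t)).2 ≠ 0 := fun δ t h0 h1 =>
    g2 _ _ ⟨δ, t, h0, h1, ChartRel.refl _ _⟩
  have e3 : ∀ v, γ (P.fan v 0) = (1, 0) := fun v => by rw [fan_zero, g3]
  rcases hP.exists_chart p with ⟨f, z, h, rfl⟩ | ⟨δ, t, h0, h1, rfl⟩ | ⟨v, rfl⟩ <;>
  rcases hP.exists_chart p' with ⟨f', z', h', rfl⟩ | ⟨δ', t', h0', h1', rfl⟩ | ⟨v', rfl⟩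
  · refine hP.separated_of_charts (c := .inl f) (c' := .inl f') h h' hne ?_
    by_cases hf : f = f'
    · exact Or.inl (by rw [hf])
    · refine Or.inr (disjoint_left.2 ?_)
      rintro _ ⟨a, ha, rfl⟩ ⟨b, hb, he⟩
      exact hf (hP.disc_inj _ _ _ _ ha hb he.symm).1
  · have := e1 f z h
    rw [hγ, (e2 δ' t' h0' h1').1] at this
    exact absurd this (lt_irrefl _)
  · have := e1 f z h
    rw [hγ, e3] at this
    exact absurd this (lt_irrefl _)
  · have := e1 f' z' h'
    rw [← hγ, (e2 δ t h0 h1).1] at this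
    exact absurd this (lt_irrefl _)
  -- A dart and its partner parametrize the same region, so the second point is first rewritten in
  -- the chart of `δ`.
  · by_cases hp : δ' = P.pair δ
    · subst hp
      have hd := hP.doubleSide_pair (δ := δ) (ζ := 1 - t') (Or.inr ⟨by simp; linarith, by simp; linarith⟩)
      rw [sub_sub_cancel] at hd
      rw [hd] at hne ⊢
      exact hP.separated_of_charts (c := .inr (.inl δ)) (c' := .inr (.inl δ))
        ⟨by simpa, by simpa⟩ ⟨by simp; linarith, by simp; linarith⟩ hne (Or.inl rfl)
    · refine hP.separated_of_charts (c := .inr (.inl δ)) (c' := .inr (.inl δ'))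
        ⟨by simpa, by simpa⟩ ⟨by simpa, by simpa⟩ hne ?_
      by_cases hf : δ = δ'
      · exact Or.inl (by rw [hf])
      · refine Or.inr (disjoint_left.2 ?_)
        rintro _ ⟨a, ha, rfl⟩ ⟨b, hb, he⟩
        rcases hP.doubleSide_inj ha.1 ha.2 hb.1 hb.2 he.symm with ⟨h, -⟩ | ⟨h, -⟩
        · exact hf h.symm
        · exact hp h
  · have := (e2 δ t h0 h1).2
    rw [hγ, e3] at this
    exact absurd rfl this
  · have := e1 f' z' h'
    rw [← hγ, e3] at this
    exact absurd this (lt_irrefl _)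
  · have := (e2 δ' t' h0' h1').2
    rw [← hγ, e3] at this
    exact absurd rfl this
  · refine hP.separated_of_charts (c := .inr (.inr v)) (c' := .inr (.inr v'))
      (by simpa [chartDomain] using radius_pos v) (by simpa [chartDomain] using radius_pos v') hne ?_
    by_cases hf : v = v'
    · exact Or.inl (by rw [hf])
    · refine Or.inr (disjoint_left.2 ?_)
      rintro _ ⟨a, ha, rfl⟩ ⟨b, hb, he⟩
      exact hf (hP.fan_inj ha hb he.symm).1

end IsSurface

/-- A compact space glued from polygons is a compact orientable surface. -/
theorem IsSurface.isCompactOrientableSurface {J : Type u} [TopologicalSpace J] [CompactSpace J]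
    {F D V : Type*} [Finite D] {P : PolygonGluing J F D V} (hP : P.IsSurface) :
    IsCompactOrientableSurface J :=
  have := hP.t2Space
  isCompactOrientableSurface_of_charts P.chartDomain P.chartMap isOpen_chartDomain
    hP.continuousOn_chartMap hP.injOn_chartMap hP.isOpen_chartMap_image hP.exists_chartMap_eq
    hP.chartRel_chartMap

end PolygonGluing
end CosetComplex

/-! ### Positions of points on cyclic orbits -/

namespace CosetComplex

section OrbitIndex

variable {G : Type*} [Group G] {S : Type u} [MulAction Gᵐᵒᵖ S]

theorem period_op_pos [Finite S] (g : G) (s : S) : 0 < MulAction.period (MulOpposite.op g) s := by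
  have : MulAction.period (MulOpposite.op g) s =
      MulAction.period (MulAction.toPermHom Gᵐᵒᵖ S (MulOpposite.op g)) s := rfl
  rw [this]
  exact MulAction.period_pos_of_orderOf_pos (orderOf_pos _) _

theorem mk_smul_op (g : G) (s : S) : (⟦s <• g⟧ : CyclicOrbit S g) = ⟦s⟧ :=
  Quotient.sound ⟨⟨MulOpposite.op g, Subgroup.mem_zpowers _⟩, rfl⟩

theorem smul_pow_add_period (g : G) (s : S) (i : ℕ) :
    s <• g ^ (i + MulAction.period (MulOpposite.op g) s) = s <• g ^ i := by
  rw [MulOpposite.op_pow, pow_add, mul_smul, MulAction.pow_period_smul, ← MulOpposite.op_pow]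

theorem exists_orbitIndex [Finite S] (g : G) (s : S) :
    ∃ i < MulAction.period (MulOpposite.op g) (⟦s⟧ : CyclicOrbit S g).out,
      (⟦s⟧ : CyclicOrbit S g).out <• g ^ i = s := by
  let r := MulAction.orbitRel (Subgroup.zpowers (MulOpposite.op g)) S
  obtain ⟨⟨_, ⟨n, rfl⟩⟩, hn⟩ := r.symm (Quotient.exact (Quotient.out_eq (⟦s⟧ : CyclicOrbit S g)))
  set a := (⟦s⟧ : CyclicOrbit S g).out
  have hp : (0 : ℤ) < MulAction.period (MulOpposite.op g) a := by exact_mod_cast period_op_pos g a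
  have h0 := Int.emod_nonneg n hp.ne'
  refine ⟨(n % MulAction.period (MulOpposite.op g) a).toNat, ?_, ?_⟩
  · have := Int.emod_lt_of_pos n hp
    omega
  · rw [MulOpposite.op_pow, ← zpow_natCast, Int.toNat_of_nonneg h0,
      MulAction.zpow_mod_period_smul]
    exact hn

/-- The position of a point on its orbit. -/
noncomputable def orbitIndex [Finite S] (g : G) (s : S) : ℕ := (exists_orbitIndex g s).choose

variable [Finite S]

theorem orbitIndex_lt (g : G) (s : S) :
    orbitIndex g s < MulAction.period (MulOpposite.op g) (⟦s⟧ : CyclicOrbit S g).out :=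
  (exists_orbitIndex g s).choose_spec.1

theorem out_orbitIndex (g : G) (s : S) :
    (⟦s⟧ : CyclicOrbit S g).out <• g ^ orbitIndex g s = s :=
  (exists_orbitIndex g s).choose_spec.2

/-- The index grows by one except where it wraps around, hence the congruence modulo the period. -/
theorem orbitIndex_smul (g : G) (s : S) : ∃ k : ℤ, (orbitIndex g (s <• g) : ℤ) =
    orbitIndex g s + 1 + k * MulAction.period (MulOpposite.op g) (⟦s⟧ : CyclicOrbit S g).out := by
  have h := out_orbitIndex g (s <• g)
  rw [mk_smul_op] at h
  have h' : (⟦s⟧ : CyclicOrbit S g).out <• g ^ (orbitIndex g s + 1) = s <• g := by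
    rw [pow_succ, MulOpposite.op_mul, mul_smul, out_orbitIndex]
  have : MulOpposite.op g ^ ((orbitIndex g (s <• g) : ℤ) - (orbitIndex g s + 1 : ℕ)) •
      (⟦s⟧ : CyclicOrbit S g).out = (⟦s⟧ : CyclicOrbit S g).out := by
    rw [sub_eq_neg_add, zpow_add, mul_smul, zpow_neg, inv_smul_eq_iff, zpow_natCast, zpow_natCast,
      ← MulOpposite.op_pow, ← MulOpposite.op_pow, h, h']
  rw [MulAction.zpow_smul_eq_iff_period_dvd] at this
  obtain ⟨k, hk⟩ := this
  refine ⟨k, ?_⟩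
  push_cast at hk
  linear_combination hk

theorem eq_of_orbitIndex {g : G} {s s' : S} (h : (⟦s⟧ : CyclicOrbit S g) = ⟦s'⟧)
    (h' : ∃ k : ℤ, (orbitIndex g s : ℤ) = orbitIndex g s' +
      k * MulAction.period (MulOpposite.op g) (⟦s'⟧ : CyclicOrbit S g).out) : s = s' := by
  obtain ⟨k, hk⟩ := h'
  have h1 := out_orbitIndex g s
  rw [h, MulOpposite.op_pow, ← zpow_natCast, hk, zpow_add, mul_smul,
    MulAction.zpow_smul_eq_iff_period_dvd.2 (Dvd.intro_left _ rfl), zpow_natCast,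
    ← MulOpposite.op_pow, out_orbitIndex] at h1
  exact h1.symm

end OrbitIndex
end CosetComplex

/-! ### The cells of `J` and functions that respect the gluing -/

namespace CosetComplex

variable {k l : ℕ} {S : Type u} [MulAction (TriangleGroup k l)ᵐᵒᵖ S]

@[simp] theorem smul_gen_x_smul_gen_x (s : S) : s <• gen k l Gen.x <• gen k l Gen.x = s := by
  have h : (gen k l Gen.x) ^ 2 = 1 :=
    (PresentedGroup.one_of_mem (rels := triangleRels k l) (x := FreeGroup.of Gen.x ^ 2)
      (by simp [triangleRels]))
  rw [← mul_smul, ← MulOpposite.op_mul, ← sq, h, MulOpposite.op_one, one_smul]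

theorem smul_gen_xy (s : S) :
    s <• (gen k l Gen.x * gen k l Gen.y) = s <• gen k l Gen.x <• gen k l Gen.y := by
  rw [MulOpposite.op_mul, mul_smul]

/-- The point of the complex at parameter `t` on the edge `e`. -/
noncomputable def edgeMap (e : Edge S) (t : ℝ) : J k l S :=
  Quot.mk _ (edgePt k l e (projIcc 0 1 zero_le_one t))

/-- The vertex `s` of the complex. -/
def vertexMap (s : S) : J k l S := Quot.mk _ (vertexPt k l s)

theorem edgeMap_coe (e : Edge S) (t : unitInterval) :
    (edgeMap e t : J k l S) = Quot.mk _ (edgePt k l e t) := by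
  rw [edgeMap, projIcc_val]

theorem edgeMap_zero (e : Edge S) : (edgeMap e 0 : J k l S) = vertexMap e.2 := by
  have := edgeMap_coe (k := k) (l := l) e 0
  rw [Set.Icc.coe_zero] at this
  exact this.trans (Quot.sound (Glue.source e.1 e.2))

theorem edgeMap_one (e : Edge S) : (edgeMap e 1 : J k l S) = vertexMap (e.2 <• gen k l e.1) := by
  have := edgeMap_coe (k := k) (l := l) e 1
  rw [Set.Icc.coe_one] at this
  exact this.trans (Quot.sound (Glue.target e.1 e.2))

theorem edgeMap_flip {s : S} (hs : s <• gen k l Gen.x ≠ s) {t : ℝ} (h0 : 0 ≤ t) (h1 : t ≤ 1) :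
    (edgeMap (Gen.x, s) t : J k l S) = edgeMap (Gen.x, s <• gen k l Gen.x) (1 - t) := by
  lift t to unitInterval using ⟨h0, h1⟩
  rw [edgeMap_coe, ← unitInterval.coe_symm_eq, edgeMap_coe]
  exact Quot.sound (Glue.flip s hs t)

/-- The radial retraction of the plane to the closed unit disc. -/
noncomputable def toDisc (z : ℂ) : Metric.closedBall (0 : ℂ) 1 :=
  ⟨z / (max 1 ‖z‖ : ℝ), by
    have : 0 < max 1 ‖z‖ := lt_max_of_lt_left one_pos
    rw [mem_closedBall_zero_iff, norm_div, Complex.norm_real, Real.norm_of_nonneg this.le,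
      div_le_one this]
    exact le_max_right _ _⟩

theorem toDisc_coe {z : ℂ} (h : ‖z‖ ≤ 1) : (toDisc z : ℂ) = z := by
  simp [toDisc, max_eq_left h]

theorem continuous_toDisc : Continuous toDisc := by
  refine Continuous.subtype_mk (Continuous.div continuous_id (by fun_prop) fun z => ?_) _
  have : 0 < max 1 ‖z‖ := lt_max_of_lt_left one_pos
  exact_mod_cast this.ne'

theorem coe_boundaryPoint (n : ℕ) (x : ℝ) :
    (boundaryPoint (2 * Real.pi * x / n) : ℂ) = discParam n x := by
  simp only [boundaryPoint, Circle.coe_exp, discParam]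
  congr 1
  push_cast
  ring

theorem boundaryPoint_eq_iff {n : ℕ} (hn : 0 < n) {x x' : ℝ} :
    boundaryPoint (2 * Real.pi * x / n) = boundaryPoint (2 * Real.pi * x' / n) ↔
      ∃ m : ℤ, x = x' + m * n := by
  rw [← Subtype.coe_inj, coe_boundaryPoint, coe_boundaryPoint, discParam_eq_iff hn]
  exact exists_congr fun m => by norm_cast

/-- The orientation of the faces: the `xy`-faces are oriented by their boundary circuits, the other
faces are oriented against them. -/
noncomputable def Face.orient : Face k l S → ℂ → ℂ
  | .xyFace _, z => z
  | _, z => starRingEnd ℂ z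

namespace Face

variable (f : Face k l S)

@[simp] theorem norm_orient (z : ℂ) : ‖f.orient z‖ = ‖z‖ := by
  cases f <;> simp [orient]

@[simp] theorem orient_orient (z : ℂ) : f.orient (f.orient z) = z := by
  cases f <;> simp [orient]

theorem continuous_orient : Continuous f.orient := by
  cases f
  · exact Complex.continuous_conj
  · exact Complex.continuous_conj
  · exact continuous_id

theorem norm_one_sub_orient_pow (z : ℂ) (n : ℕ) : ‖1 - f.orient z ^ n‖ = ‖1 - z ^ n‖ := by
  have : ‖1 - (starRingEnd ℂ z) ^ n‖ = ‖1 - z ^ n‖ := by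
    rw [← Complex.norm_conj (1 - z ^ n)]; simp
  cases f <;> simp [orient, this]

theorem sides_pos [Finite S] : 0 < f.sides := by
  cases f with
  | xMonogon s hs => exact one_pos
  | yFace o => exact period_op_pos _ _
  | xyFace o => exact Nat.mul_pos two_pos (period_op_pos _ _)

/-- The disc of a face, mapped to the complex compatibly with the orientation. -/
noncomputable def toComplex (z : ℂ) : J k l S := Quot.mk _ (facePt f (toDisc (f.orient z)))

theorem continuous_toComplex : Continuous f.toComplex := by
  have h1 : Continuous (facePt f) := continuous_inr.comp (continuous_inr.comp continuous_sigmaMk)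
  exact continuous_quot_mk.comp (h1.comp (continuous_toDisc.comp f.continuous_orient))

theorem toComplex_orient_coe (z : Metric.closedBall (0 : ℂ) 1) :
    f.toComplex (f.orient z) = Quot.mk _ (facePt f z) := by
  rw [toComplex, orient_orient]
  congr 2
  exact Subtype.ext (toDisc_coe (mem_closedBall_zero_iff.1 z.2))

theorem toComplex_orient_discParam (j : ℕ) (hj : j < f.sides) {t : ℝ} (h0 : 0 ≤ t) (h1 : t ≤ 1) :
    f.toComplex (f.orient (discParam f.sides (j + t))) = edgeMap (f.side j) t := by
  lift t to unitInterval using ⟨h0, h1⟩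
  have := coe_boundaryPoint f.sides (j + t)
  push_cast at this
  rw [← this, toComplex_orient_coe, edgeMap_coe]
  exact Quot.sound (Glue.attach f j hj t)

theorem side_target (j : ℕ) :
    (f.side j).2 <• gen k l (f.side j).1 = (f.side (j + 1)).2 := by
  cases f with
  | xMonogon s hs => exact hs
  | yFace o => simp only [side, pow_succ, MulOpposite.op_mul, mul_smul]
  | xyFace o =>
    rcases Nat.even_or_odd' j with ⟨i, rfl | rfl⟩
    · have h1 : (2 * i + 1) / 2 = i := by omega
      have h2 : 2 * i / 2 = i := by omega
      have h3 : (2 * i + 1) % 2 ≠ 0 := by omega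
      simp only [side, h1, h2, if_neg h3, Nat.mul_mod_right, if_true, MulOpposite.op_mul, mul_smul]
    · have h1 : (2 * i + 1) / 2 = i := by omega
      have h2 : (2 * i + 1 + 1) / 2 = i + 1 := by omega
      have h3 : (2 * i + 1) % 2 ≠ 0 := by omega
      have h4 : (2 * i + 1 + 1) % 2 = 0 := by omega
      simp only [side, h1, h2, if_neg h3, if_pos h4, pow_succ, MulOpposite.op_mul, mul_smul]

theorem side_add_sides (j : ℕ) : f.side (j + f.sides) = f.side j := by
  cases f with
  | xMonogon s hs => rfl
  | yFace o =>
    simp only [side, sides, smul_pow_add_period]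
  | xyFace o =>
    have h1 : ∀ p, (j + 2 * p) % 2 = j % 2 := by omega
    have h2 : ∀ p, (j + 2 * p) / 2 = j / 2 + p := by omega
    rw [side, side, sides, h1, h2, smul_pow_add_period, MulOpposite.op_mul (_ ^ _), mul_smul,
      smul_pow_add_period, ← mul_smul, ← MulOpposite.op_mul]

theorem side_add_mul_sides (j m : ℕ) : f.side (j + m * f.sides) = f.side j := by
  induction m with
  | zero => simp
  | succ m ih => rw [add_mul, one_mul, ← add_assoc, side_add_sides, ih]

/-- Sides are periodic, which covers the corner where the last side meets side 0. -/
theorem side_congr {j j' : ℕ} {m : ℤ} (h : (j : ℤ) = j' + m * f.sides) : f.side j = f.side j' := by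
  rcases le_total 0 m with hm | hm
  · lift m to ℕ using hm
    rw [show j = j' + m * f.sides by exact_mod_cast h, side_add_mul_sides]
  · obtain ⟨m, rfl⟩ : ∃ n : ℕ, m = -n := ⟨(-m).toNat, by omega⟩
    rw [show j' = j + m * f.sides by zify; linear_combination -h, side_add_mul_sides]

end Face

/-- The condition that a point of the cells lies over the vertex `s₀`. -/
def OverVertex (s₀ : S) : Cells k l S → Prop
  | .inl ⟨s, _⟩ => s = s₀
  | .inr (.inl ⟨e, t⟩) => (t = 0 ∧ e.2 = s₀) ∨ (t = 1 ∧ e.2 <• gen k l e.1 = s₀)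
  | .inr (.inr ⟨f, z⟩) => ∃ j : ℕ, z = boundaryPoint (2 * Real.pi * (j : ℝ) / (f.sides : ℝ)) ∧
      (f.side j).2 = s₀

/-- A predicate that respects `Glue` descends to `J`, so the generated equivalence relation never
has to be described. This one shows that distinct vertices stay distinct. -/
theorem overVertex_glue [Finite S] (s₀ : S) {p q : Cells k l S} (h : Glue k l S p q) :
    OverVertex s₀ p ↔ OverVertex s₀ q := by
  cases h with
  | source a s => simp [OverVertex, edgePt, vertexPt]
  | target a s => simp [OverVertex, edgePt, vertexPt]
  | flip s hs t =>
    simp only [OverVertex, edgePt, smul_gen_x_smul_gen_x, unitInterval.symm_eq_zero,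
      unitInterval.symm_eq_one]
    exact or_comm
  | attach f j hj t =>
    simp only [OverVertex, edgePt, facePt]
    constructor
    · rintro ⟨j', he, rfl⟩
      obtain ⟨m, hm⟩ := (boundaryPoint_eq_iff f.sides_pos).1 he
      -- A parameter in `[0, 1]` that is an integer is an endpoint of the edge.
      have ht : (t : ℝ) = ((j' + m * f.sides - j : ℤ) : ℝ) := by push_cast; linarith
      have h0 : (0 : ℤ) ≤ j' + m * f.sides - j := by
        have := t.2.1; rw [ht] at this; exact_mod_cast this
      have h1 : (j' + m * f.sides - j : ℤ) ≤ 1 := by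
        have := t.2.2; rw [ht] at this; exact_mod_cast this
      have h01 : (j' + m * f.sides - j : ℤ) = 0 ∨ (j' + m * f.sides - j : ℤ) = 1 := by omega
      rcases h01 with h | h <;> rw [h] at ht
      · refine Or.inl ⟨Subtype.ext (by simpa using ht), ?_⟩
        rw [f.side_congr (j := j) (j' := j') (m := m) (by linarith)]
      · refine Or.inr ⟨Subtype.ext (by simpa using ht), ?_⟩
        rw [f.side_target, f.side_congr (j := j + 1) (j' := j') (m := m) (by push_cast; linarith)]
    · rintro (⟨rfl, h⟩ | ⟨rfl, h⟩)
      · exact ⟨j, by simp, h⟩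
      · exact ⟨j + 1, by simp, by rw [← f.side_target, h]⟩

theorem vertexMap_injective [Finite S] : Function.Injective (vertexMap : S → J k l S) := by
  intro s s' h
  have := congrArg (Quot.lift (OverVertex s) fun _ _ h => propext (overVertex_glue s h)) h
  exact (this.mp rfl).symm

/-- The condition that the point of parameter `t` on the edge `e` is identified with the one of
parameter `t₀` on the edge `e₀`. -/
def SameEdgePt (e₀ : Edge S) (t₀ : ℝ) (e : Edge S) (t : ℝ) : Prop :=
  (e = e₀ ∧ t = t₀) ∨ ∃ s, s <• gen k l Gen.x ≠ s ∧ e₀ = (Gen.x, s) ∧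
    e = (Gen.x, s <• gen k l Gen.x) ∧ t = 1 - t₀

/-- The condition that a point of the cells lies over the point of parameter `t₀` on the edge
`e₀`. -/
def OverEdgePt (e₀ : Edge S) (t₀ : ℝ) : Cells k l S → Prop
  | .inl _ => False
  | .inr (.inl ⟨e, t⟩) => SameEdgePt (k := k) (l := l) e₀ t₀ e t
  | .inr (.inr ⟨f, z⟩) => ∃ j < f.sides, ∃ t : unitInterval,
      z = boundaryPoint (2 * Real.pi * ((j : ℝ) + (t : ℝ)) / (f.sides : ℝ)) ∧
      SameEdgePt (k := k) (l := l) e₀ t₀ (f.side j) t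

theorem SameEdgePt.mem_Ioo {e₀ e : Edge S} {t₀ t : ℝ} (h0 : 0 < t₀) (h1 : t₀ < 1)
    (h : SameEdgePt (k := k) (l := l) e₀ t₀ e t) : 0 < t ∧ t < 1 := by
  rcases h with ⟨-, rfl⟩ | ⟨-, -, -, -, rfl⟩
  · exact ⟨h0, h1⟩
  · constructor <;> linarith

theorem overEdgePt_glue [Finite S] (e₀ : Edge S) {t₀ : ℝ} (h0 : 0 < t₀) (h1 : t₀ < 1)
    {p q : Cells k l S} (h : Glue k l S p q) : OverEdgePt e₀ t₀ p ↔ OverEdgePt e₀ t₀ q := by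
  cases h with
  | source a s =>
    exact iff_of_false (fun h => absurd (h.mem_Ioo h0 h1).1 (by simp)) id
  | target a s =>
    exact iff_of_false (fun h => absurd (h.mem_Ioo h0 h1).2 (by simp)) id
  | flip s hs t =>
    change SameEdgePt _ _ _ _ ↔ SameEdgePt _ _ _ _
    constructor
    · rintro (⟨rfl, rfl⟩ | ⟨s', hs', rfl, h, ht⟩)
      · exact Or.inr ⟨s, hs, rfl, rfl, by simp⟩
      · simp only [Prod.mk.injEq, true_and] at h
        subst h
        exact Or.inl ⟨by simp, by simp [ht]⟩
    · rintro (⟨rfl, h⟩ | ⟨s', hs', rfl, h, ht⟩)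
      · refine Or.inr ⟨s <• gen k l Gen.x, by simpa using hs.symm, rfl, by simp, ?_⟩
        rw [← h]; simp
      · simp only [Prod.mk.injEq, true_and, smul_left_cancel_iff] at h
        subst h
        refine Or.inl ⟨rfl, ?_⟩
        simpa using ht
  | attach f j hj t =>
    change (∃ j' < f.sides, ∃ t' : unitInterval, _ ∧ _) ↔ SameEdgePt _ _ _ _
    constructor
    · rintro ⟨j', hj', t', he, h⟩
      obtain ⟨h0', h1'⟩ := h.mem_Ioo h0 h1
      obtain ⟨m, hm⟩ := (boundaryPoint_eq_iff f.sides_pos).1 he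
      have a := t.2.1
      have b := t.2.2
      have c1 : (j : ℤ) < j' + m * f.sides + 1 := by
        have : (j : ℝ) < j' + m * f.sides + 1 := by linarith
        exact_mod_cast this
      have c2 : (j' + m * f.sides : ℤ) - 1 < j := by
        have : (j' + m * f.sides : ℝ) - 1 < j := by linarith
        exact_mod_cast this
      have hjj : (j : ℤ) = j' + m * f.sides := by omega
      -- Both `j` and `j'` lie in `[0, sides)`, so congruent indices are equal.
      have hm0 : m = 0 := by
        have hn : (0 : ℤ) < f.sides := by exact_mod_cast f.sides_pos
        by_contra hm0
        rcases lt_or_gt_of_ne hm0 with h | h <;> nlinarith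
      subst hm0
      have : j = j' := by omega
      subst this
      rw [show (t : ℝ) = t' by simpa using hm]
      exact h
    · exact fun h => ⟨j, hj, t, rfl, h⟩

theorem sameEdgePt_of_edgeMap_eq [Finite S] {e e' : Edge S} {t t' : ℝ} (h0 : 0 < t) (h1 : t < 1)
    (h0' : 0 ≤ t') (h1' : t' ≤ 1) (h : (edgeMap e t : J k l S) = edgeMap e' t') :
    SameEdgePt (k := k) (l := l) e t e' t' := by
  lift t to unitInterval using ⟨h0.le, h1.le⟩
  lift t' to unitInterval using ⟨h0', h1'⟩
  rw [edgeMap_coe, edgeMap_coe] at h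
  have := congrArg
    (Quot.lift (OverEdgePt e t) fun _ _ h => propext (overEdgePt_glue e h0 h1 h)) h
  exact this.mp (Or.inl ⟨rfl, rfl⟩)

/-- The point of the open disc of a face over which a point of the cells lies, if any. -/
noncomputable def innerPt : Cells k l S → Option (Face k l S × ℂ)
  | .inl _ => none
  | .inr (.inl _) => none
  | .inr (.inr ⟨f, z⟩) => open Classical in if ‖(z : ℂ)‖ < 1 then some (f, (z : ℂ)) else none

theorem norm_boundaryPoint (θ : ℝ) : ‖(boundaryPoint θ : ℂ)‖ = 1 := by
  simp [boundaryPoint]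

theorem innerPt_glue {p q : Cells k l S} (h : Glue k l S p q) : innerPt p = innerPt q := by
  cases h with
  | attach f j hj t => simp [innerPt, facePt, edgePt, norm_boundaryPoint]
  | _ => rfl

theorem Face.toComplex_inj {f f' : Face k l S} {z z' : ℂ} (hz : ‖z‖ < 1) (hz' : ‖z'‖ < 1)
    (h : f.toComplex z = f'.toComplex z') : f = f' ∧ z = z' := by
  have := congrArg (Quot.lift innerPt fun _ _ h => innerPt_glue h) h
  have e : ∀ {f : Face k l S} {z : ℂ}, ‖z‖ < 1 →
      innerPt (facePt f (toDisc (f.orient z))) = some (f, f.orient z) := by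
    intro f z hz
    simp [innerPt, facePt, toDisc_coe ((f.norm_orient z).trans_le hz.le), hz]
  have h2 := (e hz).symm.trans (this.trans (e hz'))
  simp only [Option.some.injEq, Prod.mk.injEq] at h2
  obtain ⟨rfl, h2⟩ := h2
  exact ⟨rfl, by rw [← f.orient_orient z, h2, f.orient_orient]⟩

/-- The level function that separates vertices, edges and faces. -/
noncomputable def cellLevel : Cells k l S → ℝ × ℝ
  | .inl _ => (1, 0)
  | .inr (.inl ⟨_, t⟩) => (1, ‖1 - Complex.exp (2 * Real.pi * Complex.I * (t : ℝ))‖)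
  | .inr (.inr ⟨f, z⟩) => (‖(z : ℂ)‖, ‖1 - (z : ℂ) ^ f.sides‖)

/-- On the `j`-th side `z ^ n = exp (2πi (j + t)) = exp (2πi t)`, independent of `j` and `n`; the
reversal `t ↦ 1 - t` conjugates this number and leaves the norm unchanged. -/
theorem cellLevel_glue [Finite S] {p q : Cells k l S} (h : Glue k l S p q) :
    cellLevel p = cellLevel q := by
  cases h with
  | source a s => simp [cellLevel, edgePt, vertexPt]
  | target a s => simp [cellLevel, edgePt, vertexPt]
  | flip s hs t =>
    simp only [cellLevel, edgePt, unitInterval.coe_symm_eq, Prod.mk.injEq, true_and]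
    rw [← Complex.norm_conj]
    simp only [map_sub, map_one, ← Complex.exp_conj, map_mul, Complex.conj_I, Complex.conj_ofReal,
      map_ofNat]
    congr 2
    push_cast
    rw [show (2 * Real.pi * Complex.I * (1 - (t : ℝ)) : ℂ) =
      2 * Real.pi * -Complex.I * (t : ℝ) + 2 * Real.pi * Complex.I by ring,
      Complex.exp_add, Complex.exp_two_pi_mul_I, mul_one]
  | attach f j hj t =>
    simp only [cellLevel, edgePt, facePt, norm_boundaryPoint, Prod.mk.injEq, true_and]
    rw [coe_boundaryPoint, discParam_pow f.sides_pos]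
    congr 2
    exact Complex.exp_eq_exp_iff_exists_int.2 ⟨j, by push_cast; ring⟩

theorem continuous_cellLevel : Continuous (cellLevel : Cells k l S → ℝ × ℝ) := by
  refine continuous_sum_dom.2 ⟨continuous_const, continuous_sum_dom.2
    ⟨continuous_sigma fun e => ?_, continuous_sigma fun f => ?_⟩⟩
  · change Continuous fun t : unitInterval =>
      ((1 : ℝ), ‖1 - Complex.exp (2 * Real.pi * Complex.I * (t : ℝ))‖)
    fun_prop
  · change Continuous fun z : Metric.closedBall (0 : ℂ) 1 => (‖(z : ℂ)‖, ‖1 - (z : ℂ) ^ f.sides‖)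
    fun_prop

end CosetComplex

/-! ### The darts of `J` and the verification of the gluing conditions -/

namespace CosetComplex

section

variable (k l : ℕ) (S : Type u) [MulAction (TriangleGroup k l)ᵐᵒᵖ S]

/-- The sides of the faces: those of the `y`-faces, those of the `xy`-faces along an `x`-edge or
along a `y`-edge, and those of the monogons, labelled by the start point of the edge. -/
inductive Dart : Type u
  | y (s : S)
  | xyx (s : S)
  | xyy (s : S)
  | mono (s : S) (hs : s <• gen k l Gen.x = s)

end

variable {k l : ℕ} {S : Type u} [MulAction (TriangleGroup k l)ᵐᵒᵖ S]

namespace Dart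

/-- The edge along which a dart runs. -/
def edge : Dart k l S → Edge S
  | y s => (Gen.y, s)
  | xyx s => (Gen.x, s)
  | xyy s => (Gen.y, s)
  | mono s _ => (Gen.x, s)

/-- The next dart on the oriented boundary of the face. -/
def next : Equiv.Perm (Dart k l S) where
  toFun
    | y s => y (s <• (gen k l Gen.y)⁻¹)
    | xyx s => xyy (s <• gen k l Gen.x)
    | xyy s => xyx (s <• gen k l Gen.y)
    | mono s hs => mono s hs
  invFun
    | y s => y (s <• gen k l Gen.y)
    | xyx s => xyy (s <• (gen k l Gen.y)⁻¹)
    | xyy s => xyx (s <• gen k l Gen.x)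
    | mono s hs => mono s hs
  left_inv := by rintro (s | s | s | s) <;> simp
  right_inv := by rintro (s | s | s | s) <;> simp

/-- The other dart along the same edge. -/
noncomputable def partner : Dart k l S → Dart k l S
  | y s => xyy s
  | xyx s => open Classical in
      if hs : s <• gen k l Gen.x = s then mono s hs else xyx (s <• gen k l Gen.x)
  | xyy s => y s
  | mono s _ => xyx s

theorem partner_partner : Function.Involutive (partner : Dart k l S → Dart k l S) := by
  rintro (s | s | s | ⟨s, hs⟩)
  · rfl
  · by_cases hs : s <• gen k l Gen.x = s
    · simp [partner, hs]
    · have : s ≠ s <• gen k l Gen.x := Ne.symm hs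
      simp [partner, hs, this]
  · rfl
  · simp [partner, hs]

theorem partner_ne (δ : Dart k l S) : δ.partner ≠ δ := by
  rcases δ with s | s | s | ⟨s, hs⟩
  · simp [partner]
  · by_cases hs : s <• gen k l Gen.x = s <;> simp [partner, hs]
  · simp [partner]
  · simp [partner]

/-- The start vertex of a dart. -/
def vert : Dart k l S → S
  | y s => s <• gen k l Gen.y
  | xyx s => s
  | xyy s => s
  | mono s _ => s

/-- The face of a dart. -/
def face : Dart k l S → Face k l S
  | y s => .yFace ⟦s⟧
  | xyx s => .xyFace ⟦s⟧
  | xyy s => .xyFace ⟦s <• gen k l Gen.x⟧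
  | mono s hs => .xMonogon s hs

/-- The parameter on the edge of a dart which belongs to a parameter on the dart. -/
def param : Dart k l S → ℝ → ℝ
  | y _, t => 1 - t
  | xyx _, t => t
  | xyy _, t => t
  | mono _ _, t => 1 - t

theorem param_mem_Ioo (δ : Dart k l S) {t : ℝ} (h0 : 0 < t) (h1 : t < 1) :
    0 < δ.param t ∧ δ.param t < 1 := by
  cases δ <;> constructor <;> simp only [param] <;> linarith

instance [Finite S] : Finite (Dart k l S) := by
  refine Finite.of_injective (β := Fin 4 × S) (fun
    | y s => (0, s)
    | xyx s => (1, s)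
    | xyy s => (2, s)
    | mono s _ => (3, s)) ?_
  rintro (s | s | s | s) (s' | s' | s' | s') <;> simp

variable [Finite S]

/-- The position of a dart on the oriented boundary of its face. -/
noncomputable def pos : Dart k l S → ℤ
  | y s => -orbitIndex (gen k l Gen.y) s - 1
  | xyx s => 2 * orbitIndex (gen k l Gen.x * gen k l Gen.y) s
  | xyy s => 2 * orbitIndex (gen k l Gen.x * gen k l Gen.y) (s <• gen k l Gen.x) + 1
  | mono _ _ => -1

end Dart

section

variable (k l : ℕ) (S : Type u) [MulAction (TriangleGroup k l)ᵐᵒᵖ S] [Finite S]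

/-- The complex as a surface glued from polygons. -/
noncomputable def gluing : PolygonGluing (J k l S) (Face k l S) (Dart k l S) S where
  disc := Face.toComplex
  sides := Face.sides
  face := Dart.face
  pos := Dart.pos
  next := Dart.next
  pair := Dart.partner_partner.toPerm
  vert := Dart.vert
  base := Dart.xyx

end

variable [Finite S]

theorem conj_discParam (n : ℕ) (x : ℝ) :
    starRingEnd ℂ (discParam n x) = discParam n (-x : ℝ) := by
  simp only [discParam, ← Complex.exp_conj]
  congr 1
  simp [map_ofNat]

/-- This ties the abstract sides to the attaching maps: darts of `xy`-faces follow their edges,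
while darts of `y`-faces and monogons run through them backwards. -/
theorem gluing_side (δ : Dart k l S) {t : ℝ} (h0 : 0 ≤ t) (h1 : t ≤ 1) :
    (gluing k l S).side δ t = edgeMap δ.edge (δ.param t) := by
  have h0' : 0 ≤ 1 - t := by linarith
  have h1' : 1 - t ≤ 1 := by linarith
  change δ.face.toComplex (discParam δ.face.sides (δ.pos + t)) = _
  rcases δ with s | s | s | ⟨s, hs⟩
  · have h := Face.toComplex_orient_discParam (.yFace ⟦s⟧ : Face k l S) _
      (orbitIndex_lt (gen k l Gen.y) s) h0' h1'
    rw [Face.side, out_orbitIndex] at h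
    refine Eq.trans ?_ h
    congr 1
    -- Conjugation sends the arc `[i, i + 1]` to `[-i - 1, -i]`, which explains the position `-i -
    -- 1` and the parameter `1 - t`.
    rw [Face.orient, ← Complex.ofReal_natCast, ← Complex.ofReal_add, conj_discParam]
    · congr 1
      simp only [Dart.pos]
      push_cast
      ring
    · simp
  · have hi := orbitIndex_lt (gen k l Gen.x * gen k l Gen.y) s
    have h := Face.toComplex_orient_discParam (.xyFace ⟦s⟧ : Face k l S)
      (2 * orbitIndex (gen k l Gen.x * gen k l Gen.y) s) (by simp only [Face.sides]; omega) h0 h1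
    rw [Face.side, if_pos (by omega), Nat.mul_div_cancel_left _ two_pos, out_orbitIndex] at h
    refine Eq.trans ?_ h
    congr 1
  · have hi := orbitIndex_lt (gen k l Gen.x * gen k l Gen.y) (s <• gen k l Gen.x)
    have h := Face.toComplex_orient_discParam (.xyFace ⟦s <• gen k l Gen.x⟧ : Face k l S)
      (2 * orbitIndex (gen k l Gen.x * gen k l Gen.y) (s <• gen k l Gen.x) + 1)
      (by simp only [Face.sides]; omega) h0 h1
    rw [Face.side, if_neg (by omega), show ∀ i, (2 * i + 1) / 2 = i by omega,
      MulOpposite.op_mul (_ ^ _), mul_smul, out_orbitIndex, smul_gen_x_smul_gen_x] at h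
    refine Eq.trans ?_ h
    congr 1
  · have h := Face.toComplex_orient_discParam (.xMonogon s hs : Face k l S) 0 one_pos h0' h1'
    rw [Face.side] at h
    refine Eq.trans ?_ h
    congr 1
    rw [Face.orient, ← Complex.ofReal_natCast, ← Complex.ofReal_add, conj_discParam]
    · congr 1
      simp only [Dart.pos]
      push_cast
      ring
    · simp

theorem gluing_side_zero (δ : Dart k l S) : (gluing k l S).side δ 0 = vertexMap δ.vert := by
  have h := gluing_side δ le_rfl zero_le_one
  rw [Complex.ofReal_zero] at h
  rw [h]
  rcases δ with s | s | s | ⟨s, hs⟩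
  · rw [Dart.param, sub_zero, edgeMap_one]; rfl
  · rw [Dart.param, edgeMap_zero]; rfl
  · rw [Dart.param, edgeMap_zero]; rfl
  · rw [Dart.param, sub_zero, edgeMap_one]; exact congrArg _ hs

theorem Dart.dart_ext (δ δ' : Dart k l S) (h : δ.face = δ'.face)
    (hp : ∃ m : ℤ, δ.pos = δ'.pos + m * δ'.face.sides) : δ = δ' := by
  obtain ⟨m, hm⟩ := hp
  rcases δ with s | s | s | ⟨s, hs⟩ <;> rcases δ' with s' | s' | s' | ⟨s', hs'⟩ <;>
    simp only [face, reduceCtorEq, Face.yFace.injEq, Face.xyFace.injEq, Face.xMonogon.injEq] at h <;>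
    simp only [pos, face, Face.sides] at hm
  · rw [eq_of_orbitIndex h ⟨-m, by linear_combination -hm⟩]
  · push_cast at hm
    rw [eq_of_orbitIndex h ⟨m, by linarith⟩]
  -- On an `xy`-face, `x`-sides have even and `y`-sides odd positions, and the number of sides is
  -- even.
  · push_cast at hm
    rw [mul_left_comm] at hm
    omega
  · push_cast at hm
    rw [mul_left_comm] at hm
    omega
  · push_cast at hm
    have := eq_of_orbitIndex h ⟨m, by linarith⟩
    rw [smul_left_cancel_iff] at this
    rw [this]
  · subst h; rfl

/-- Exactly two darts run along each edge of the quotient, in opposite directions. The last cases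
exclude a monogon on an edge that `x` moves. -/
theorem gluing_edge_inj (δ δ' : Dart k l S) (t t' : ℝ) (h0 : 0 < t) (h1 : t < 1) (h0' : 0 < t')
    (h1' : t' < 1) (h : (gluing k l S).side δ t = (gluing k l S).side δ' t') :
    (δ' = δ ∧ t' = t) ∨ (δ' = δ.partner ∧ t' = 1 - t) := by
  rw [gluing_side δ h0.le h1.le, gluing_side δ' h0'.le h1'.le] at h
  obtain ⟨a, b⟩ := δ.param_mem_Ioo h0 h1
  obtain ⟨a', b'⟩ := δ'.param_mem_Ioo h0' h1'
  have key := sameEdgePt_of_edgeMap_eq a b a'.le b'.le h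
  clear h a b a' b'
  rcases δ with s | s | s | ⟨s, hs⟩ <;> rcases δ' with s' | s' | s' | ⟨s', hs'⟩ <;>
    rcases key with ⟨he, ht⟩ | ⟨r, hr, he, he', ht⟩ <;>
    simp only [Dart.edge, Dart.param, Prod.mk.injEq, reduceCtorEq, true_and, false_and] at * <;>
    subst_vars
  all_goals first
    | exact Or.inl ⟨rfl, by linarith⟩
    | exact Or.inr ⟨rfl, by linarith⟩
    | exact absurd (hs'.symm.trans (smul_gen_x_smul_gen_x _)) hr
    | exact absurd ‹_› hr
    | (refine Or.inr ⟨?_, by linarith⟩; simp [Dart.partner, *])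

instance : Finite Gen :=
  Finite.of_injective (fun | .x => true | .y => false : Gen → Bool)
    (by rintro (_ | _) (_ | _) <;> simp)

instance : Finite (Face k l S) := by
  refine Finite.of_injective (β := S ⊕ CyclicOrbit S (gen k l Gen.y) ⊕
    CyclicOrbit S (gen k l Gen.x * gen k l Gen.y)) (fun
    | .xMonogon s _ => .inl s
    | .yFace o => .inr (.inl o)
    | .xyFace o => .inr (.inr o)) ?_
  rintro (s | s | s) (s' | s' | s') <;> simp

instance : CompactSpace (J k l S) :=
  have : CompactSpace (Metric.closedBall (0 : ℂ) 1) :=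
    isCompact_iff_compactSpace.1 (isCompact_closedBall 0 1)
  inferInstanceAs (CompactSpace (Quot (Glue k l S)))

theorem exists_side_eq_edge (e : Edge S) : ∃ f : Face k l S, ∃ j < f.sides, f.side j = e := by
  rcases e with ⟨_ | _, s⟩
  · have hi := orbitIndex_lt (gen k l Gen.x * gen k l Gen.y) s
    refine ⟨.xyFace ⟦s⟧, 2 * orbitIndex (gen k l Gen.x * gen k l Gen.y) s,
      by simp only [Face.sides]; omega, ?_⟩
    rw [Face.side, if_pos (by omega), Nat.mul_div_cancel_left _ two_pos, out_orbitIndex]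
  · exact ⟨.yFace ⟦s⟧, _, orbitIndex_lt (gen k l Gen.y) s, by rw [Face.side, out_orbitIndex]⟩

/-- Every edge is a side of some face, so its preimage is pulled back from a disc along an arc of
the boundary; on the vertices there is nothing to check. -/
theorem isOpen_of_faces (O : Set (J k l S)) (hO : ∀ (f : Face k l S) (z : ℂ), ‖z‖ ≤ 1 →
    f.toComplex z ∈ O → ∀ᶠ z' in 𝓝 z, ‖z'‖ ≤ 1 → f.toComplex z' ∈ O) : IsOpen O := by
  have hf : ∀ f : Face k l S, IsOpen {z : Metric.closedBall (0 : ℂ) 1 |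
      (Quot.mk _ (facePt f z) : J k l S) ∈ O} := by
    intro f
    rw [isOpen_iff_mem_nhds]
    intro z hz
    change (Quot.mk _ (facePt f z) : J k l S) ∈ O at hz
    rw [← f.toComplex_orient_coe] at hz
    have h := hO f _ ((f.norm_orient _).trans_le (mem_closedBall_zero_iff.1 z.2)) hz
    have hc : Continuous fun z : Metric.closedBall (0 : ℂ) 1 => f.orient (z : ℂ) :=
      f.continuous_orient.comp continuous_subtype_val
    filter_upwards [hc.continuousAt.eventually h] with w hw
    rw [← f.toComplex_orient_coe]
    exact hw ((f.norm_orient _).trans_le (mem_closedBall_zero_iff.1 w.2))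
  change IsOpen (Quot.mk (Glue k l S) ⁻¹' O)
  rw [isOpen_sum_iff, isOpen_sum_iff, isOpen_sigma_iff, isOpen_sigma_iff, isOpen_sigma_iff]
  refine ⟨fun _ => isOpen_discrete _, fun e => ?_, hf⟩
  obtain ⟨f, j, hj, rfl⟩ := exists_side_eq_edge (k := k) (l := l) e
  have hc : Continuous fun t : unitInterval =>
      boundaryPoint (2 * Real.pi * ((j : ℝ) + (t : ℝ)) / (f.sides : ℝ)) := by
    refine Continuous.subtype_mk ?_ _
    fun_prop
  convert (hf f).preimage hc using 1
  ext t
  exact iff_of_eq (congrArg (· ∈ O) (Quot.sound (Glue.attach f j hj t)).symm)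

theorem toComplex_surj (p : J k l S) : ∃ (f : Face k l S) (z : ℂ), ‖z‖ ≤ 1 ∧ f.toComplex z = p := by
  have he : ∀ (e : Edge S) (t : ℝ), 0 ≤ t → t ≤ 1 → ∃ (f : Face k l S) (z : ℂ), ‖z‖ ≤ 1 ∧
      f.toComplex z = edgeMap e t := by
    intro e t h0 h1
    obtain ⟨f, j, hj, rfl⟩ := exists_side_eq_edge (k := k) (l := l) e
    refine ⟨f, _, ?_, f.toComplex_orient_discParam j hj h0 h1⟩
    rw [f.norm_orient, norm_discParam_le_one f.sides_pos]
    simp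
  obtain ⟨c, rfl⟩ := Quot.exists_rep p
  rcases c with ⟨s, _⟩ | ⟨e, t⟩ | ⟨f, z⟩
  · obtain ⟨f, z, hz, h⟩ := he (Gen.x, s) 0 le_rfl zero_le_one
    exact ⟨f, z, hz, h.trans (edgeMap_zero _)⟩
  · obtain ⟨f, z, hz, h⟩ := he e t t.2.1 t.2.2
    exact ⟨f, z, hz, h.trans (edgeMap_coe _ _)⟩
  · exact ⟨f, _, (f.norm_orient _).trans_le (mem_closedBall_zero_iff.1 z.2), f.toComplex_orient_coe z⟩

theorem isSurface_gluing : (gluing k l S).IsSurface where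
  sides_pos f := f.sides_pos
  continuous_disc f := f.continuous_toComplex
  disc_surj := toComplex_surj
  isOpen_of := isOpen_of_faces
  disc_inj f f' z z' hz hz' h := Face.toComplex_inj hz hz' h
  exists_level := by
    refine ⟨Quot.lift cellLevel fun _ _ h => cellLevel_glue h,
      continuous_quot_lift _ continuous_cellLevel, fun f z hz => ?_⟩
    change cellLevel (facePt f (toDisc (f.orient z))) = (‖z‖, ‖1 - z ^ f.sides‖)
    simp only [cellLevel, facePt]
    rw [toDisc_coe (by simpa), f.norm_orient, f.norm_one_sub_orient_pow]
  face_surj f := by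
    rcases f with ⟨s, hs⟩ | o | o
    · exact ⟨.mono s hs, rfl⟩
    · exact ⟨.y o.out, congrArg Face.yFace (Quotient.out_eq o)⟩
    · exact ⟨.xyx o.out, congrArg Face.xyFace (Quotient.out_eq o)⟩
  face_next δ := by
    rcases δ with s | s | s | ⟨s, hs⟩
    · refine congrArg Face.yFace ?_
      rw [← mk_smul_op (gen k l Gen.y)]
      simp
    · exact congrArg Face.xyFace (by simp)
    · refine congrArg Face.xyFace ?_
      rw [← mk_smul_op _ (s <• gen k l Gen.x), smul_gen_xy, smul_gen_x_smul_gen_x]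
    · rfl
  pos_next δ := by
    change ∃ m : ℤ, (Dart.next δ).pos = δ.pos + 1 + m * δ.face.sides
    rcases δ with s | s | s | ⟨s, hs⟩
    · obtain ⟨m, hm⟩ := orbitIndex_smul (gen k l Gen.y) (s <• (gen k l Gen.y)⁻¹)
      rw [← mk_smul_op (gen k l Gen.y) (s <• (gen k l Gen.y)⁻¹)] at hm
      simp only [MulOpposite.op_inv, smul_inv_smul] at hm
      refine ⟨m, ?_⟩
      simp only [Dart.next, Dart.pos, Dart.face, Face.sides, Equiv.coe_fn_mk, MulOpposite.op_inv]
      linear_combination hm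
    · refine ⟨0, ?_⟩
      simp [Dart.next, Dart.pos]
    · obtain ⟨m, hm⟩ := orbitIndex_smul (gen k l Gen.x * gen k l Gen.y) (s <• gen k l Gen.x)
      rw [smul_gen_xy, smul_gen_x_smul_gen_x] at hm
      refine ⟨m, ?_⟩
      simp only [Dart.next, Dart.pos, Dart.face, Face.sides, Equiv.coe_fn_mk]
      push_cast
      linear_combination 2 * hm
    · exact ⟨-1, by simp [Dart.next, Dart.pos, Dart.face, Face.sides]⟩
  dart_ext := Dart.dart_ext
  pair_pair := Dart.partner_partner
  pair_ne := Dart.partner_ne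
  glue δ t h0 h1 := by
    classical
    change _ = (gluing k l S).side δ.partner (1 - t)
    rw [← Complex.ofReal_one, ← Complex.ofReal_sub, gluing_side δ h0 h1,
      gluing_side δ.partner (by linarith) (by linarith)]
    rcases δ with s | s | s | ⟨s, hs⟩
    · simp [Dart.partner, Dart.param, Dart.edge]
    · by_cases hs : s <• gen k l Gen.x = s
      · simp [Dart.partner, Dart.param, Dart.edge, hs]
      · simp [Dart.partner, Dart.param, Dart.edge, hs, edgeMap_flip hs h0 h1]
    · simp [Dart.partner, Dart.param, Dart.edge]
    · simp [Dart.partner, Dart.param, Dart.edge]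
  edge_inj := gluing_edge_inj
  vert_eq δ δ' h := by
    rw [gluing_side_zero, gluing_side_zero] at h
    exact vertexMap_injective h
  vert_base s := rfl
  exists_rotate δ := by
    -- The cycle around `s` is `xyx s`, `y (s ^ y⁻¹)`, `xyy s`, then `mono s` if `x` fixes `s`, and
    -- back to `xyx s`. The exponents 1, 0, 2, 3 below are read off from it.
    have h1 : ∀ s : S, (gluing k l S).rotate (.xyx (s <• gen k l Gen.y)) = .y s := fun s => by
      change Dart.partner (.xyy (s <• gen k l Gen.y <• (gen k l Gen.y)⁻¹)) = _
      simp [Dart.partner]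
    have h2 : ∀ s : S, (gluing k l S).rotate (.y s) = .xyy (s <• gen k l Gen.y) := fun s => rfl
    have h3 : ∀ s : S, (gluing k l S).rotate (.xyy s) = Dart.partner (.xyx (s <• gen k l Gen.x)) :=
      fun s => rfl
    have h4 : ∀ s : S, ((gluing k l S).rotate ^ (2 : ℤ)) (.xyx s) = .xyy s := fun s => by
      have h5 := h1 (s <• (gen k l Gen.y)⁻¹)
      have h6 := h2 (s <• (gen k l Gen.y)⁻¹)
      simp only [MulOpposite.op_inv, smul_inv_smul] at h5 h6
      rw [zpow_two, Equiv.Perm.mul_apply, h5, h6]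
    rcases δ with s | s | s | ⟨s, hs⟩
    · exact ⟨1, (h1 s).symm⟩
    · exact ⟨0, rfl⟩
    · exact ⟨2, (h4 s).symm⟩
    · refine ⟨1 + 2, ?_⟩
      change Dart.mono s hs = ((gluing k l S).rotate ^ (1 + 2 : ℤ)) (Dart.xyx s)
      rw [zpow_add, zpow_one, Equiv.Perm.mul_apply, h4, h3, hs]
      simp [Dart.partner, hs]

end CosetComplex

/-! ### Connectedness -/

namespace CosetComplex

variable {k l : ℕ} {S : Type u} [MulAction (TriangleGroup k l)ᵐᵒᵖ S]

theorem connectedComponent_vertexMap_smul_gen (a : Gen) (s : S) :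
    connectedComponent (vertexMap (s <• gen k l a) : J k l S) = connectedComponent (vertexMap s) := by
  have hc : Continuous fun t : unitInterval => (Quot.mk _ (edgePt k l (a, s) t) : J k l S) :=
    continuous_quot_mk.comp
      (continuous_inr.comp (continuous_inl.comp (continuous_sigmaMk (i := (a, s)))))
  have h := (isPreconnected_range hc).subset_connectedComponent (mem_range_self 0) (mem_range_self 1)
  rw [← edgeMap_coe, ← edgeMap_coe, Set.Icc.coe_zero, Set.Icc.coe_one, edgeMap_zero,
    edgeMap_one] at h
  exact (connectedComponent_eq h).symm

theorem connectedComponent_vertexMap_smul (g : TriangleGroup k l) (s : S) :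
    connectedComponent (vertexMap (s <• g) : J k l S) = connectedComponent (vertexMap s) := by
  have hg : g ∈ Subgroup.closure (range (PresentedGroup.of (rels := triangleRels k l))) := by
    rw [PresentedGroup.closure_range_of]; trivial
  induction hg using Subgroup.closure_induction generalizing s with
  | mem _ h => obtain ⟨a, rfl⟩ := h; exact connectedComponent_vertexMap_smul_gen a s
  | one => simp
  | mul g h _ _ ihg ihh => rw [MulOpposite.op_mul, mul_smul, ihh, ihg]
  | inv g _ ih => rw [← ih, MulOpposite.op_inv, smul_inv_smul]

variable [Finite S]

/-- Each point lies in the connected image of a closed disc, which also contains the start vertex of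
side 0. -/
theorem exists_connectedComponent_eq (p : J k l S) :
    ∃ s : S, connectedComponent p = connectedComponent (vertexMap s) := by
  obtain ⟨f, z, hz, rfl⟩ := toComplex_surj p
  have hc := ((convex_closedBall (0 : ℂ) 1).isPreconnected.image f.toComplex
    f.continuous_toComplex.continuousOn).subset_connectedComponent
      (mem_image_of_mem _ (mem_closedBall_zero_iff.2 hz))
  have h1 : f.orient (discParam f.sides 0) ∈ Metric.closedBall (0 : ℂ) 1 := by
    rw [mem_closedBall_zero_iff, f.norm_orient, norm_discParam_le_one f.sides_pos]
    simp
  have h2 := f.toComplex_orient_discParam 0 f.sides_pos le_rfl zero_le_one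
  rw [Nat.cast_zero, Complex.ofReal_zero, add_zero, edgeMap_zero] at h2
  exact ⟨_, connectedComponent_eq (h2 ▸ hc (mem_image_of_mem _ h1))⟩

theorem connectedSpace [Nonempty S] [MulAction.IsPretransitive (TriangleGroup k l)ᵐᵒᵖ S] :
    ConnectedSpace (J k l S) := by
  obtain ⟨s₀⟩ := ‹Nonempty S›
  have h : ∀ p : J k l S, connectedComponent p = connectedComponent (vertexMap s₀) := fun p => by
    obtain ⟨s, hs⟩ := exists_connectedComponent_eq p
    obtain ⟨g, rfl⟩ := MulAction.exists_smul_eq (TriangleGroup k l)ᵐᵒᵖ s₀ s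
    rw [hs, ← connectedComponent_vertexMap_smul g.unop s₀, MulOpposite.op_unop]
  refine connectedSpace_iff_connectedComponent.2 ⟨vertexMap s₀, ?_⟩
  exact eq_univ_of_forall fun p => h p ▸ mem_connectedComponent

end CosetComplex

end

theorem mainTheorem11 (k l : ℕ) (S : Type u) [Finite S]
    [MulAction (CosetComplex.TriangleGroup k l)ᵐᵒᵖ S] :
    (∃ (M : Type u) (_ : TopologicalSpace M), CosetComplex.IsCompactOrientableSurface M ∧
      Nonempty (CosetComplex.J k l S ≃ₜ M)) ∧
    (Nonempty S → MulAction.IsPretransitive (CosetComplex.TriangleGroup k l)ᵐᵒᵖ S →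
      ConnectedSpace (CosetComplex.J k l S)) :=
  ⟨⟨CosetComplex.J k l S, inferInstance,
    CosetComplex.isSurface_gluing.isCompactOrientableSurface, ⟨Homeomorph.refl _⟩⟩,
    fun _ _ => CosetComplex.connectedSpace⟩
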